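/- **Setting.** Let $0<\alpha\le 1$, $F\subset\mathbb R$, and for $x\le y$ put $$\gamma^\alpha(F,x,y)=\lim_{\delta\to0^+}\ \inf_{|P|\le\delta}\ \sum_{i=0}^{n-1}\frac{(t_{i+1}-t_i)^\alpha}{\Gamma(\alpha+1)}\,\Theta(F,[t_i,t_{i+1}]),$$ where $P=\{x=t_0,\dots,t_n=y\}$ runs over the subdivisions of $[x,y]$ of mesh $|P|\le\delta$ and $\Theta(F,I)$ is $1$ if $F\cap I\ne\emptyset$ and $0$ otherwise. For a fixed $l\in\mathbb R$ let $S_F^\alpha(x)=\gamma^\alpha(F,l,x)$ if $x\ge l$ and $S_F^\alpha(x)=-\gamma^\alpha(F,x,l)$ if $x<l$. Assume that $F$ is $\alpha$-perfect, i.e. $\gamma^\alpha(F,x,y)<\infty$ for all $x\le y$, and $F$ is exactly the set of points $x$ such that $S_F^\alpha$ is not constant on any open interval containing $x$. Assume also $S_F^\alpha(0)=0$ (e.g. $l=0$) and $S_F^\alpha(t)\to\infty$ as $t\to\infty$. A function $h$ is *$F^\alpha$-integrable* on $[a,b]$ if it is bounded on $F\cap[a,b]$ and the supremum over all subdivisions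 of the lower sums $\sum_i \inf_{F\cap[t_i,t_{i+1}]}h\,\big(S_F^\alpha(t_{i+1})-S_F^\alpha(t_i)\big)$ equals the infimum of the upper sums, defined with $\sup$ in place of $\inf$ (either is read as $0$ if $F\cap[t_i,t_{i+1}]=\emptyset$); the common value is $\int_a^b h(t)\,d_F^\alpha t$, and $\int_0^\infty=\lim_{T\to\infty}\int_0^T$. For $f$ on $[0,\infty)$ and $x\ge 0$, put $$D_F^\alpha f(x)=\lim_{y\to x,\ y\in F,\ y\ge0,\ y\neq x}\frac{f(y)-f(x)}{S_F^\alpha(y)-S_F^\alpha(x)}\ \text{ if }x\in F,\qquad D_F^\alpha f(x)=0\ \text{ if }x\notin F.$$ (If $0$ is an isolated point of $F\cap[0,\infty)$, the value $D_F^\alpha f(0)$ is arbitrary and immaterial.) The *fractal Laplace* and *fractal Sumudu transforms* of $h$ at $v$ are $$\mathfrak L[h](v)=\int_0^\infty e^{-S_F^\alpha(v)S_F^\alpha(t)}h(t)\,d_F^\alpha t,\qquad \mathscr S[h](v)=\frac1{S_F^\alpha(v)}\int_0^\infty e^{-S_F^\alpha(t)/S_F^\alpha(v)}h(t)\,d_F^\alpha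 t\quad(S_F^\alpha(v)\ne0),$$ whenever the integrals over all $[0,T]$ and the limit as $T\to\infty$ exist. Let $0\le\gamma<1$, let $\mathcal N:\mathbb R\to\mathbb R$ satisfy $\mathcal N(0)=\mathcal N(1)=1$, and define the *wsk-fractal time derivative* (with initial time $0$) by $${}^{\mathrm{wsk}}\mathfrak D_F^\gamma f(t)=\frac{\mathcal N(\gamma)}{1-\gamma}\int_0^t e^{-\frac{\gamma(S_F^\alpha(t)-S_F^\alpha(\tau))}{1-\gamma}}\,D_F^\alpha f(\tau)\,d_F^\alpha\tau ,\qquad t\ge0.$$ **Theorem 3.4.** Let $f$ be a real function on $[0,\infty)$ that is a function of $S_F^\alpha(t)$ (i.e. $S_F^\alpha(x)=S_F^\alpha(y)$ implies $f(x)=f(y)$ for $x,y\ge0$), is $F^\alpha$-differentiable at every point of $F\cap[0,\infty)$, and whose derivative $D_F^\alpha f$ is $F^\alpha$-integrable on $[0,T]$ for every $T\ge0$. Then the integral defining ${}^{\mathrm{wsk}}\mathfrak D_F^\gamma f(t)$ exists for every $t\ge0$, and: 1. if $S_F^\alpha(v)+\frac{\gamma}{1-\gamma}>0$ and $\mathfrak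 L[f](v)$ exists, then $\mathfrak L[{}^{\mathrm{wsk}}\mathfrak D_F^\gamma f](v)$ exists and $$\mathfrak L\big[{}^{\mathrm{wsk}}\mathfrak D_F^\gamma f\big](v)=\frac{\mathcal N(\gamma)}{1-\gamma}\cdot\frac{S_F^\alpha(v)\,\mathfrak L[f](v)-f(0)}{S_F^\alpha(v)+\frac{\gamma}{1-\gamma}};$$ 2. if $S_F^\alpha(v)\ne0$, $\frac1{S_F^\alpha(v)}+\frac{\gamma}{1-\gamma}>0$ and $\mathscr S[f](v)$ exists, then $\mathscr S[{}^{\mathrm{wsk}}\mathfrak D_F^\gamma f](v)$ exists and $$\mathscr S\big[{}^{\mathrm{wsk}}\mathfrak D_F^\gamma f\big](v)=\frac{\mathcal N(\gamma)}{1-\gamma}\cdot\frac{\mathscr S[f](v)-f(0)}{1+\frac{\gamma}{1-\gamma}S_F^\alpha(v)}.$$ In particular both hold, where the transform of $f$ exists, for every $v$ with $S_F^\alpha(v)>0$. -/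

import Mathlib

open Filter Topology

/-- A subdivision `x = pt 0 ≤ pt 1 ≤ … ≤ pt n = y` of `[x, y]`; only the values `pt 0, …, pt n`
matter. Repeated points are harmless: they contribute zero to all the sums below. -/
structure Subdivision (x y : ℝ) where
  n : ℕ
  pt : ℕ → ℝ
  mono : ∀ i < n, pt i ≤ pt (i + 1)
  first : pt 0 = x
  last : pt n = y

/-- The mesh `max (pt (i+1) - pt i)` of the subdivision is at most `δ`. -/
def Subdivision.MeshLE {x y : ℝ} (P : Subdivision x y) (δ : ℝ) : Prop :=
  ∀ i < P.n, P.pt (i + 1) - P.pt i ≤ δ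

open Classical in
/-- The flag function `Θ(F, [x, y])`. -/
noncomputable def flag (F : Set ℝ) (x y : ℝ) : ℝ :=
  if (F ∩ Set.Icc x y).Nonempty then 1 else 0

/-- The sum `σ^α[F, P]`. -/
noncomputable def massSum (F : Set ℝ) (α : ℝ) {x y : ℝ} (P : Subdivision x y) : ℝ :=
  ∑ i ∈ Finset.range P.n,
    (P.pt (i + 1) - P.pt i) ^ α / Real.Gamma (α + 1) * flag F (P.pt i) (P.pt (i + 1))

/-- The coarse-grained mass `γ_δ^α(F, x, y)`. -/
noncomputable def coarseMass (F : Set ℝ) (α δ x y : ℝ) : ENNReal :=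
  ⨅ (P : Subdivision x y) (_ : P.MeshLE δ), ENNReal.ofReal (massSum F α P)

/-- The mass function `γ^α(F, x, y) ∈ [0, ∞]`, the limit of the coarse-grained mass as `δ → 0+`.
The coarse-grained mass is antitone in `δ`, so the limit is the supremum over `δ > 0`
(see `tendsto_coarseMass`). -/
noncomputable def fractalMass (F : Set ℝ) (α x y : ℝ) : ENNReal :=
  ⨆ δ ∈ Set.Ioi (0 : ℝ), coarseMass F α δ x y

theorem tendsto_coarseMass (F : Set ℝ) (α x y : ℝ) :
    Tendsto (fun δ => coarseMass F α δ x y) (𝓝[>] 0) (𝓝 (fractalMass F α x y)) := by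
  have h : Antitone (fun δ => coarseMass F α δ x y) := by
    intro δ₁ δ₂ hδ
    exact iInf_mono fun P => iInf_mono' fun hP => ⟨fun i hi => (hP i hi).trans hδ, le_rfl⟩
  have h2 := h.tendsto_nhdsGT (0 : ℝ)
  rwa [sSup_image] at h2

open Classical in
/-- The integral staircase function `S_F^α` with base point `l`. -/
noncomputable def staircase (F : Set ℝ) (α l x : ℝ) : ℝ :=
  if l ≤ x then (fractalMass F α l x).toReal else -(fractalMass F α x l).toReal

/-- The set of change of `g`: the points `x` such that `g` is not constant on any open interval
containing `x`. -/
def setOfChange (g : ℝ → ℝ) : Set ℝ :=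
  {x | ∀ c d : ℝ, c < x → x < d → ¬ ∃ k, ∀ y ∈ Set.Ioo c d, g y = k}

/-- `F` is `α`-perfect: the mass function is finite and `F` is the set of change of its
staircase function (whose set of change does not depend on the base point `l`). -/
def IsAlphaPerfect (F : Set ℝ) (α l : ℝ) : Prop :=
  (∀ x y : ℝ, x ≤ y → fractalMass F α x y ≠ ⊤) ∧ setOfChange (staircase F α l) = F

/-- The upper sum `∑ M[f, F, [x_i, x_{i+1}]] (S(x_{i+1}) - S(x_i))`, where `M[f, F, I]` is the
supremum of `f` over `F ∩ I`, and `0` if `F ∩ I` is empty. -/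
noncomputable def fractalUpperSum (F : Set ℝ) (α l : ℝ) (f : ℝ → ℝ) {a b : ℝ}
    (P : Subdivision a b) : ℝ :=
  ∑ i ∈ Finset.range P.n, sSup (f '' (F ∩ Set.Icc (P.pt i) (P.pt (i + 1)))) *
    (staircase F α l (P.pt (i + 1)) - staircase F α l (P.pt i))

/-- The lower sum, with the infimum of `f` over `F ∩ I` (and `0` if `F ∩ I` is empty). -/
noncomputable def fractalLowerSum (F : Set ℝ) (α l : ℝ) (f : ℝ → ℝ) {a b : ℝ}
    (P : Subdivision a b) : ℝ :=
  ∑ i ∈ Finset.range P.n, sInf (f '' (F ∩ Set.Icc (P.pt i) (P.pt (i + 1)))) *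
    (staircase F α l (P.pt (i + 1)) - staircase F α l (P.pt i))

/-- `f` is `F^α`-integrable on `[a, b]`, where `a ≤ b`: it is bounded on `F ∩ [a, b]`, and its
lower and upper `F^α`-integrals agree. -/
def FractalIntegrable (F : Set ℝ) (α l : ℝ) (f : ℝ → ℝ) (a b : ℝ) : Prop :=
  BddAbove (f '' (F ∩ Set.Icc a b)) ∧ BddBelow (f '' (F ∩ Set.Icc a b)) ∧
    (⨆ P : Subdivision a b, fractalLowerSum F α l f P) =
      ⨅ P : Subdivision a b, fractalUpperSum F α l f P

/-- The `F^α`-integral `∫_a^b f(t) d_F^α t` for `a ≤ b`; meaningful if `f` is `F^α`-integrable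
on `[a, b]`. -/
noncomputable def fractalIntegral (F : Set ℝ) (α l : ℝ) (f : ℝ → ℝ) (a b : ℝ) : ℝ :=
  ⨆ P : Subdivision a b, fractalLowerSum F α l f P

/-- At the point `x ∈ F`, the function `f` on the time domain `J` has `F^α`-derivative `d`: the
difference quotient with respect to the staircase function tends to `d` as `y → x` through
`F` (and within `J`). -/
def HasFractalDerivWithinAt (F : Set ℝ) (α l : ℝ) (J : Set ℝ) (f : ℝ → ℝ) (d x : ℝ) : Prop :=
  Tendsto (fun y => (f y - f x) / (staircase F α l y - staircase F α l x))
    (𝓝[(F ∩ J) \ {x}] x) (𝓝 d)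

open Classical in
/-- The `F^α`-derivative `D_F^α f` of a function on the time domain `J`: the limit above at the
points of `F`, and `0` off `F`. -/
noncomputable def fractalDerivWithin (F : Set ℝ) (α l : ℝ) (J : Set ℝ) (f : ℝ → ℝ) (x : ℝ) : ℝ :=
  if x ∈ F then
    limUnder (𝓝[(F ∩ J) \ {x}] x)
      (fun y => (f y - f x) / (staircase F α l y - staircase F α l x))
  else 0

/-- The integrand of the wsk-fractal derivative of `f : [a, ∞) → ℝ` at time `t`. -/
noncomputable def wskIntegrand (F : Set ℝ) (α l γ a : ℝ) (f : ℝ → ℝ) (t τ : ℝ) : ℝ :=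
  Real.exp (-(γ * (staircase F α l t - staircase F α l τ) / (1 - γ))) *
    fractalDerivWithin F α l (Set.Ici a) f τ

/-- The wsk-fractal time derivative of order `γ`, with normalisation function `N` and initial
time `a`. -/
noncomputable def wskDeriv (F : Set ℝ) (α l : ℝ) (N : ℝ → ℝ) (γ a : ℝ) (f : ℝ → ℝ) (t : ℝ) : ℝ :=
  N γ / (1 - γ) * fractalIntegral F α l (wskIntegrand F α l γ a f t) a t

/-- The fractal Laplace transform of `f` at `v` exists and equals `L`; the integral over
`[0, ∞)` is the limit of the `F^α`-integrals over `[0, T]` as `T → ∞`. -/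
def HasFractalLaplace (F : Set ℝ) (α l : ℝ) (f : ℝ → ℝ) (v L : ℝ) : Prop :=
  (∀ T, 0 ≤ T → FractalIntegrable F α l
    (fun t => Real.exp (-(staircase F α l v * staircase F α l t)) * f t) 0 T) ∧
  Tendsto (fun T => fractalIntegral F α l
    (fun t => Real.exp (-(staircase F α l v * staircase F α l t)) * f t) 0 T) atTop (𝓝 L)

/-- The fractal Sumudu transform of `f` at `v` exists and equals `L`. -/
def HasFractalSumudu (F : Set ℝ) (α l : ℝ) (f : ℝ → ℝ) (v L : ℝ) : Prop :=
  staircase F α l v ≠ 0 ∧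
  (∀ T, 0 ≤ T → FractalIntegrable F α l
    (fun t => Real.exp (-(staircase F α l t / staircase F α l v)) * f t) 0 T) ∧
  Tendsto (fun T => 1 / staircase F α l v * fractalIntegral F α l
    (fun t => Real.exp (-(staircase F α l t / staircase F α l v)) * f t) 0 T) atTop (𝓝 L)

/-! The staircase `S` is monotone and continuous, so it serves as a change of variable `u = S t`
that turns the calculus on `F` into ordinary calculus on `[0, ∞)`. Since `f` depends on `S` alone,
`f = g ∘ S` on `[0, ∞)` with `g = f ∘ levelMax S`, where `levelMax S u` is the last point at level
`u`. That point lies in `F`, and the fractal derivative of `f` there is the right derivative of `g`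
at `u` (`hasDerivWithinAt_comp_levelMax`). The left derivative is governed by the other end of the
level set and may differ, so `g` need not be differentiable. It is still continuous
(`continuous_comp_levelMax`), and a continuous function obeys the mean value inequality with right
derivatives only.

That inequality squeezes the increment of `g` between the lower and upper sums of `D f`, which gives
the fundamental theorem for integrable `D f`. Its weighted form `fractalIntegrable_mul`, with an
exponential weight, is an integration by parts. With `κ = γ / (1 - γ)` it shows that the
wsk-derivative at `t` is `N γ / (1 - γ)` times `G (S t)`, where `G = relaxation κ g` is the
continuous function formally solving `G' = g' - κ G`, `G 0 = 0`.

Both transforms thereby become limits of ordinary integrals of `e^(-s u) g u` and `e^(-s u) G u`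
over `[0, U]`, with `s = S v` for Laplace and `s = 1 / S v` for Sumudu. The transform of `f` may
converge only conditionally and `f` has no growth bound, so boundary terms are controlled by Abel
averaging: exponentially weighted means of the convergent partial integrals have the same limit
(`tendsto_exp_neg_mul_integral_exp_mul`). This yields the limit `(s L - g 0) / (s + κ)` in
`tendsto_integral_exp_mul_relaxation`. -/

/-! ### Subdivisions: gluing, cutting and refinement -/

namespace Subdivision

variable {x y z : ℝ}

theorem pt_le_pt (P : Subdivision x y) {i j : ℕ} (hij : i ≤ j) (hj : j ≤ P.n) :
    P.pt i ≤ P.pt j := by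
  induction j, hij using Nat.le_induction with
  | base => exact le_rfl
  | succ k _ ih => exact (ih (by omega)).trans (P.mono k (by omega))

theorem le_pt (P : Subdivision x y) {i : ℕ} (hi : i ≤ P.n) : x ≤ P.pt i :=
  P.first.symm.le.trans (P.pt_le_pt (Nat.zero_le i) hi)

theorem pt_le (P : Subdivision x y) {i : ℕ} (hi : i ≤ P.n) : P.pt i ≤ y :=
  (P.pt_le_pt hi le_rfl).trans P.last.le

/-- The sum of a function of intervals over the pieces of a subdivision. -/
def sum (P : Subdivision x y) (W : ℝ → ℝ → ℝ) : ℝ :=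
  ∑ i ∈ Finset.range P.n, W (P.pt i) (P.pt (i + 1))

theorem sum_le_sum_of_le (P : Subdivision x y) {V W : ℝ → ℝ → ℝ}
    (h : ∀ u v, x ≤ u → u ≤ v → v ≤ y → V u v ≤ W u v) : P.sum V ≤ P.sum W := by
  refine Finset.sum_le_sum fun i hi => ?_
  have hi := Finset.mem_range.1 hi
  exact h _ _ (P.le_pt hi.le) (P.mono i hi) (P.pt_le hi)

theorem sum_sub (P : Subdivision x y) (g : ℝ → ℝ) : P.sum (fun u v => g v - g u) = g y - g x := by
  unfold sum
  rw [Finset.sum_range_sub (fun i => g (P.pt i)), P.first, P.last]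

/-- Juxtaposition of subdivisions of adjacent intervals. -/
def append (P : Subdivision x y) (Q : Subdivision y z) : Subdivision x z where
  n := P.n + Q.n
  pt k := if k ≤ P.n then P.pt k else Q.pt (k - P.n)
  mono i hi := by
    rcases lt_trichotomy i P.n with h | h | h
    · rw [if_pos h.le, if_pos (by omega : i + 1 ≤ P.n)]
      exact P.mono i h
    · rw [if_pos h.le, if_neg (by omega : ¬ i + 1 ≤ P.n), h, P.last]
      exact Q.le_pt (by omega)
    · rw [if_neg (by omega : ¬ i ≤ P.n), if_neg (by omega : ¬ i + 1 ≤ P.n),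
        show i + 1 - P.n = i - P.n + 1 by omega]
      exact Q.mono _ (by omega)
  first := by simp [P.first]
  last := by
    -- If `Q` has no pieces, the last index falls into the branch of `P`, and the endpoint
    -- conditions of `Q` give `y = z`.
    by_cases h : Q.n = 0
    · have h1 := Q.first
      have h2 := Q.last
      rw [h] at h2
      simp only [h, add_zero, le_refl, if_true, P.last]
      exact h1.symm.trans h2
    · rw [if_neg (by omega), Nat.add_sub_cancel_left, Q.last]

theorem append_pt_add (P : Subdivision x y) (Q : Subdivision y z) (k : ℕ) :
    (P.append Q).pt (P.n + k) = Q.pt k := by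
  change (if P.n + k ≤ P.n then P.pt (P.n + k) else Q.pt (P.n + k - P.n)) = _
  split_ifs with h
  · obtain rfl : k = 0 := by omega
    rw [add_zero, P.last, Q.first]
  · rw [Nat.add_sub_cancel_left]

theorem append_pt_of_le (P : Subdivision x y) (Q : Subdivision y z) {k : ℕ} (hk : k ≤ P.n) :
    (P.append Q).pt k = P.pt k := if_pos hk

theorem append_sum (P : Subdivision x y) (Q : Subdivision y z) (W : ℝ → ℝ → ℝ) :
    (P.append Q).sum W = P.sum W + Q.sum W := by
  change ∑ i ∈ Finset.range (P.n + Q.n), _ = _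
  rw [Finset.sum_range_add]
  congr 1
  · refine Finset.sum_congr rfl fun i hi => ?_
    have := Finset.mem_range.1 hi
    rw [append_pt_of_le _ _ this.le, append_pt_of_le _ _ this]
  · refine Finset.sum_congr rfl fun i hi => ?_
    rw [add_assoc, append_pt_add, append_pt_add]

theorem MeshLE.append {P : Subdivision x y} {Q : Subdivision y z} {δ : ℝ} (hP : P.MeshLE δ)
    (hQ : Q.MeshLE δ) : (P.append Q).MeshLE δ := by
  intro i hi
  change i < P.n + Q.n at hi
  by_cases h : i < P.n
  · rw [append_pt_of_le _ _ h.le, append_pt_of_le _ _ h]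
    exact hP i h
  · obtain ⟨k, rfl⟩ := Nat.exists_eq_add_of_le (not_lt.1 h)
    rw [add_assoc, append_pt_add, append_pt_add]
    exact hQ k (by omega)

/-- The restriction of a subdivision of `[x, z]` to `[x, y]`. -/
def clampRight (P : Subdivision x z) (y : ℝ) (hxy : x ≤ y) (hyz : y ≤ z) : Subdivision x y where
  n := P.n
  pt k := min (P.pt k) y
  mono i hi := min_le_min_right y (P.mono i hi)
  first := by rw [P.first, min_eq_left hxy]
  last := by rw [P.last, min_eq_right hyz]

/-- The restriction of a subdivision of `[x, z]` to `[y, z]`. -/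
def clampLeft (P : Subdivision x z) (y : ℝ) (hxy : x ≤ y) (hyz : y ≤ z) : Subdivision y z where
  n := P.n
  pt k := max (P.pt k) y
  mono i hi := max_le_max_right y (P.mono i hi)
  first := by rw [P.first, max_eq_right hxy]
  last := by rw [P.last, max_eq_left hyz]

/-- The subdivision of `[x, y]` into a single piece. -/
def single (x y : ℝ) (h : x ≤ y) : Subdivision x y where
  n := 1
  pt k := if k = 0 then x else y
  mono i hi := by
    obtain rfl : i = 0 := by omega
    simpa using h
  first := by simp
  last := by simp

theorem single_sum (h : x ≤ y) (W : ℝ → ℝ → ℝ) : (single x y h).sum W = W x y := by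
  simp [single, sum]

/-- The subdivision of `[x, x]` without pieces. -/
def trivial (x : ℝ) : Subdivision x x where
  n := 0
  pt _ := x
  mono _ _ := le_rfl
  first := rfl
  last := rfl

/-- The subdivision of `[x, y]` into `m + 1` pieces of equal length. -/
noncomputable def uniform (x y : ℝ) (h : x ≤ y) (m : ℕ) : Subdivision x y where
  n := m + 1
  pt k := x + k * ((y - x) / (m + 1))
  mono i _ := by
    have : 0 ≤ (y - x) / (m + 1) := div_nonneg (sub_nonneg.2 h) (by positivity)
    push_cast
    linarith
  first := by simp
  last := by
    push_cast
    field_simp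
    ring

theorem uniform_meshLE (h : x ≤ y) (m : ℕ) :
    (uniform x y h m).MeshLE ((y - x) / (m + 1)) := by
  intro i _
  simp only [uniform]
  push_cast
  linarith

theorem exists_meshLE (h : x ≤ y) {δ : ℝ} (hδ : 0 < δ) : ∃ P : Subdivision x y, P.MeshLE δ := by
  obtain ⟨m, hm⟩ := exists_nat_gt ((y - x) / δ)
  refine ⟨uniform x y h m, fun i hi => (uniform_meshLE h m i hi).trans ?_⟩
  rw [div_lt_iff₀ hδ] at hm
  rw [div_le_iff₀ (by positivity)]
  nlinarith

/-- Subdivisions of the pieces of a subdivision can be glued together. -/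
theorem exists_glue (P : Subdivision x y) (V W : ℝ → ℝ → ℝ)
    (h : ∀ u v, x ≤ u → u ≤ v → v ≤ y → ∃ Q : Subdivision u v, V u v ≤ Q.sum W) :
    ∃ Q : Subdivision x y, P.sum V ≤ Q.sum W := by
  have key : ∀ j ≤ P.n, ∃ Q : Subdivision x (P.pt j),
      ∑ i ∈ Finset.range j, V (P.pt i) (P.pt (i + 1)) ≤ Q.sum W := by
    intro j
    induction j with
    | zero =>
      intro _
      rw [P.first]
      exact ⟨trivial x, by simp [trivial, sum]⟩
    | succ j ih =>
      intro hj
      obtain ⟨Q, hQ⟩ := ih (by omega)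
      obtain ⟨R, hR⟩ := h _ _ (P.le_pt (by omega : j ≤ P.n)) (P.mono j hj) (P.pt_le hj)
      refine ⟨Q.append R, ?_⟩
      rw [append_sum, Finset.sum_range_succ]
      exact add_le_add hQ hR
  have := key P.n le_rfl
  rw [P.last] at this
  exact this

end Subdivision

/-! ### Additivity of the mass function -/

section Mass

variable {F : Set ℝ} {α : ℝ}

/-- The contribution of a single interval to the sum `massSum`. -/
noncomputable def pieceMass (F : Set ℝ) (α x y : ℝ) : ℝ :=
  (y - x) ^ α / Real.Gamma (α + 1) * flag F x y

theorem massSum_eq_sum {x y : ℝ} (P : Subdivision x y) :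
    massSum F α P = P.sum (pieceMass F α) := rfl

theorem flag_nonneg (x y : ℝ) : 0 ≤ flag F x y := by
  unfold flag; split_ifs <;> norm_num

theorem flag_le_one (x y : ℝ) : flag F x y ≤ 1 := by
  unfold flag; split_ifs <;> norm_num

theorem flag_mono {x y x' y' : ℝ} (hx : x' ≤ x) (hy : y ≤ y') : flag F x y ≤ flag F x' y' := by
  by_cases h : (F ∩ Set.Icc x y).Nonempty
  · have h' : (F ∩ Set.Icc x' y').Nonempty :=
      h.mono (Set.inter_subset_inter_right _ (Set.Icc_subset_Icc hx hy))
    simp [flag, h, h']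
  · rw [show flag F x y = 0 by simp [flag, h]]
    exact flag_nonneg _ _

theorem pieceMass_nonneg (hα : 0 < α) {x y : ℝ} (h : x ≤ y) : 0 ≤ pieceMass F α x y :=
  mul_nonneg (div_nonneg (Real.rpow_nonneg (sub_nonneg.2 h) _)
    (Real.Gamma_pos_of_pos (by linarith)).le) (flag_nonneg _ _)

/-- Because `0 ^ α = 0` for `α > 0`, the repeated points produced by clamping a subdivision cost
nothing. -/
theorem pieceMass_self (hα : 0 < α) (x : ℝ) : pieceMass F α x x = 0 := by
  simp [pieceMass, Real.zero_rpow hα.ne']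

theorem pieceMass_mono (hα : 0 < α) {x y x' y' : ℝ} (hx : x' ≤ x) (h : x ≤ y) (hy : y ≤ y') :
    pieceMass F α x y ≤ pieceMass F α x' y' := by
  have hΓ := Real.Gamma_pos_of_pos (show 0 < α + 1 by linarith)
  refine mul_le_mul ?_ (flag_mono hx hy) (flag_nonneg _ _)
    (div_nonneg (Real.rpow_nonneg (by linarith) _) hΓ.le)
  gcongr

theorem pieceMass_le (hα : 0 < α) {x y δ : ℝ} (h : x ≤ y) (hδ : y - x ≤ δ) :
    pieceMass F α x y ≤ δ ^ α / Real.Gamma (α + 1) := by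
  have hΓ := Real.Gamma_pos_of_pos (show 0 < α + 1 by linarith)
  have h0 : 0 ≤ (y - x) ^ α / Real.Gamma (α + 1) :=
    div_nonneg (Real.rpow_nonneg (by linarith) _) hΓ.le
  calc pieceMass F α x y ≤ (y - x) ^ α / Real.Gamma (α + 1) * 1 :=
        mul_le_mul_of_nonneg_left (flag_le_one _ _) h0
    _ ≤ δ ^ α / Real.Gamma (α + 1) := by
        rw [mul_one]
        gcongr

theorem massSum_nonneg (hα : 0 < α) {x y : ℝ} (P : Subdivision x y) : 0 ≤ massSum F α P :=
  Finset.sum_nonneg fun i hi => pieceMass_nonneg hα (P.mono i (Finset.mem_range.1 hi))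

theorem coarseMass_le {x y δ : ℝ} {P : Subdivision x y} (hP : P.MeshLE δ) :
    coarseMass F α δ x y ≤ ENNReal.ofReal (massSum F α P) := iInf₂_le P hP

theorem coarseMass_le_add (δ x y z : ℝ) :
    coarseMass F α δ x z ≤ coarseMass F α δ x y + coarseMass F α δ y z := by
  unfold coarseMass
  refine ENNReal.le_iInf₂_add_iInf₂ fun P hP Q hQ => ?_
  refine (iInf₂_le (P.append Q) (hP.append hQ)).trans ?_
  rw [massSum_eq_sum, Subdivision.append_sum]
  exact ENNReal.ofReal_add_le

/-- Cutting a subdivision at `y` splits at most one piece, of length at most `δ`. One half is paid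
for by the original piece and the other by the error term, which vanishes as `δ → 0`. -/
theorem coarseMass_add_le (hα : 0 < α) {δ x y z : ℝ} (hδ : 0 ≤ δ) (hxy : x ≤ y) (hyz : y ≤ z) :
    coarseMass F α δ x y + coarseMass F α δ y z ≤
      coarseMass F α δ x z + ENNReal.ofReal (δ ^ α / Real.Gamma (α + 1)) := by
  have hΓ := Real.Gamma_pos_of_pos (show 0 < α + 1 by linarith)
  have hK : 0 ≤ δ ^ α / Real.Gamma (α + 1) := div_nonneg (Real.rpow_nonneg hδ _) hΓ.le
  set K := δ ^ α / Real.Gamma (α + 1) with hKdef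
  conv_rhs => unfold coarseMass
  simp_rw [ENNReal.iInf_add]
  refine le_iInf₂ fun P hP => ?_
  have hR : (P.clampRight y hxy hyz).MeshLE δ := fun i hi => by
    have := P.mono i hi
    have := hP i hi
    change min _ _ - min _ _ ≤ δ
    rcases le_total (P.pt (i + 1)) y with h | h <;> rcases le_total (P.pt i) y with h' | h' <;>
      simp only [min_eq_left, min_eq_right, h, h'] <;> linarith
  have hL : (P.clampLeft y hxy hyz).MeshLE δ := fun i hi => by
    have := P.mono i hi
    have := hP i hi
    change max _ _ - max _ _ ≤ δ
    rcases le_total (P.pt (i + 1)) y with h | h <;> rcases le_total (P.pt i) y with h' | h' <;>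
      simp only [max_eq_left, max_eq_right, h, h'] <;> linarith
  refine (add_le_add (coarseMass_le hR) (coarseMass_le hL)).trans ?_
  rw [← ENNReal.ofReal_add (massSum_nonneg hα _) (massSum_nonneg hα _),
    ← ENNReal.ofReal_add (massSum_nonneg hα _) hK]
  apply ENNReal.ofReal_le_ofReal
  classical
  -- The increment of this step function is `K` on a piece that crosses `y` and `0` on all others,
  -- so telescoping it charges the error to the right piece.
  set χ : ℝ → ℝ := fun t => if y ≤ t then K else 0 with hχ
  have hsum : massSum F α P + (χ z - χ x) ≤ massSum F α P + K := by
    simp only [hχ, if_pos hyz]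
    split_ifs <;> linarith
  refine le_trans ?_ hsum
  rw [← P.sum_sub χ]
  simp only [massSum_eq_sum, Subdivision.sum]
  rw [← Finset.sum_add_distrib]
  change ∑ i ∈ Finset.range P.n, pieceMass F α (min _ y) (min _ y) +
    ∑ i ∈ Finset.range P.n, pieceMass F α (max _ y) (max _ y) ≤ _
  rw [← Finset.sum_add_distrib]
  refine Finset.sum_le_sum fun i hi => ?_
  have hi := Finset.mem_range.1 hi
  have h1 := P.mono i hi
  have h2 := hP i hi
  generalize P.pt i = p at *
  generalize P.pt (i + 1) = q at *
  rcases le_or_gt q y with h | h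
  · rw [min_eq_left h, min_eq_left (h1.trans h), max_eq_right h, max_eq_right (h1.trans h),
      pieceMass_self hα]
    have : χ p ≤ χ q := by
      simp only [hχ]
      split_ifs <;> linarith
    linarith
  · rcases le_or_gt y p with h' | h'
    · rw [min_eq_right h.le, min_eq_right h', max_eq_left h.le, max_eq_left h',
        pieceMass_self hα]
      simp only [hχ, if_pos h', if_pos h.le]
      linarith
    · rw [min_eq_right h.le, min_eq_left h'.le, max_eq_left h.le, max_eq_right h'.le]
      simp only [hχ, if_neg (not_le.2 h'), if_pos h.le, sub_zero]
      exact add_le_add (pieceMass_mono hα le_rfl h'.le h.le) (pieceMass_le hα h.le (by linarith))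

theorem tendsto_ofReal_rpow_div (hα : 0 < α) :
    Tendsto (fun δ : ℝ => ENNReal.ofReal (δ ^ α / Real.Gamma (α + 1))) (𝓝 0) (𝓝 0) := by
  have h1 : Tendsto (fun δ : ℝ => δ ^ α) (𝓝 0) (𝓝 0) := by
    have := (Real.continuousAt_rpow_const 0 α (Or.inr hα.le)).tendsto
    rwa [Real.zero_rpow hα.ne'] at this
  have := ENNReal.tendsto_ofReal (h1.div_const (Real.Gamma (α + 1)))
  simpa using this

theorem fractalMass_add (hα : 0 < α) {x y z : ℝ} (hxy : x ≤ y) (hyz : y ≤ z) :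
    fractalMass F α x y + fractalMass F α y z = fractalMass F α x z := by
  have hadd := (tendsto_coarseMass F α x y).add (tendsto_coarseMass F α y z)
  apply le_antisymm
  · have hr := (tendsto_coarseMass F α x z).add
      ((tendsto_ofReal_rpow_div hα).mono_left nhdsWithin_le_nhds)
    rw [add_zero] at hr
    exact le_of_tendsto_of_tendsto hadd hr
      (eventually_mem_nhdsWithin.mono fun δ (hδ : 0 < δ) => coarseMass_add_le hα hδ.le hxy hyz)
  · exact le_of_tendsto_of_tendsto (tendsto_coarseMass F α x z) hadd
      (Eventually.of_forall fun δ => coarseMass_le_add δ x y z)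

theorem coarseMass_le_rpow (hα : 0 < α) {x y δ : ℝ} (hxy : x ≤ y) (hδ : y - x ≤ δ) :
    coarseMass F α δ x y ≤ ENNReal.ofReal ((y - x) ^ α / Real.Gamma (α + 1)) := by
  refine (iInf₂_le (Subdivision.single x y hxy) fun i hi => ?_).trans ?_
  · have : i = 0 := by
      change i < 1 at hi
      omega
    subst this
    simpa [Subdivision.single] using hδ
  · rw [massSum_eq_sum, Subdivision.single_sum]
    exact ENNReal.ofReal_le_ofReal (pieceMass_le hα hxy le_rfl)

theorem coarseMass_le_fractalMass {x y δ : ℝ} (hδ : 0 < δ) :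
    coarseMass F α δ x y ≤ fractalMass F α x y :=
  le_iSup₂ (f := fun δ (_ : δ ∈ Set.Ioi (0 : ℝ)) => coarseMass F α δ x y) δ hδ

theorem fractalMass_eq_zero_of_inter_eq_empty {x y : ℝ} (hxy : x ≤ y)
    (h : F ∩ Set.Icc x y = ∅) : fractalMass F α x y = 0 := by
  have : ∀ δ ∈ Set.Ioi (0 : ℝ), coarseMass F α δ x y = 0 := fun δ hδ => by
    obtain ⟨P, hP⟩ := Subdivision.exists_meshLE hxy (Set.mem_Ioi.1 hδ)
    refine le_antisymm ((iInf₂_le P hP).trans ?_) (zero_le)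
    rw [massSum_eq_sum]
    have : P.sum (pieceMass F α) ≤ 0 := by
      refine Finset.sum_nonpos fun i hi => ?_
      have hi := Finset.mem_range.1 hi
      have : flag F (P.pt i) (P.pt (i + 1)) ≤ flag F x y := flag_mono (P.le_pt hi.le) (P.pt_le hi)
      have h0 : flag F x y = 0 := by simp [flag, h]
      have h1 : flag F (P.pt i) (P.pt (i + 1)) = 0 :=
        le_antisymm (this.trans h0.le) (flag_nonneg _ _)
      simp [pieceMass, h1]
    simp [ENNReal.ofReal_of_nonpos this]
  unfold fractalMass
  exact le_antisymm (iSup₂_le fun δ hδ => (this δ hδ).le) (zero_le)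

end Mass

/-! ### Monotonicity and continuity of the staircase function -/

section Staircase

variable {F : Set ℝ} {α l : ℝ}

theorem staircase_sub (hα : 0 < α) (hfin : ∀ x y : ℝ, x ≤ y → fractalMass F α x y ≠ ⊤)
    {x y : ℝ} (hxy : x ≤ y) :
    staircase F α l y - staircase F α l x = (fractalMass F α x y).toReal := by
  have key : ∀ {a b c : ℝ}, a ≤ b → b ≤ c → (fractalMass F α a c).toReal =
      (fractalMass F α a b).toReal + (fractalMass F α b c).toReal := fun {a b c} hab hbc => by
    rw [← ENNReal.toReal_add (hfin _ _ hab) (hfin _ _ hbc), fractalMass_add hα hab hbc]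
  unfold staircase
  rcases le_or_gt l x with h | h
  · rw [if_pos h, if_pos (h.trans hxy), key h hxy]
    ring
  · rw [if_neg (not_le.2 h)]
    split_ifs with h'
    · rw [key h.le h']
      ring
    · rw [key hxy (not_le.1 h').le]
      ring

theorem staircase_monotone (hα : 0 < α) (hfin : ∀ x y : ℝ, x ≤ y → fractalMass F α x y ≠ ⊤) :
    Monotone (staircase F α l) := fun x y hxy => by
  have := staircase_sub (l := l) hα hfin hxy
  have h0 : 0 ≤ (fractalMass F α x y).toReal := ENNReal.toReal_nonneg
  linarith

theorem staircase_eq_of_inter_eq_empty (hα : 0 < α)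
    (hfin : ∀ x y : ℝ, x ≤ y → fractalMass F α x y ≠ ⊤) {x y : ℝ} (hxy : x ≤ y)
    (h : F ∩ Set.Icc x y = ∅) : staircase F α l x = staircase F α l y := by
  have := staircase_sub (l := l) hα hfin hxy
  rw [fractalMass_eq_zero_of_inter_eq_empty hxy h, ENNReal.toReal_zero] at this
  linarith

/-- Short intervals have small coarse-grained mass, so a bound of the coarse-grained mass up to
the contribution of intervals of vanishing length is a bound of the mass. -/
theorem fractalMass_le_of_eventually (hα : 0 < α) {x z : ℝ} {c : ENNReal} {p : Filter ℝ}
    [p.NeBot] {a b : ℝ → ℝ} (hab : ∀ᶠ t in p, a t ≤ b t)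
    (hlen : Tendsto (fun t => b t - a t) p (𝓝 0))
    (h : ∀ δ > 0, ∀ᶠ t in p, coarseMass F α δ x z ≤ coarseMass F α δ (a t) (b t) + c) :
    fractalMass F α x z ≤ c := by
  refine iSup₂_le fun δ hδ => ?_
  have hδ : 0 < δ := hδ
  have ht : Tendsto (fun t => ENNReal.ofReal ((b t - a t) ^ α / Real.Gamma (α + 1)) + c) p
      (𝓝 (0 + c)) := ((tendsto_ofReal_rpow_div hα).comp hlen).add_const c
  rw [zero_add] at ht
  refine ge_of_tendsto ht ?_
  filter_upwards [hab, h δ hδ, hlen.eventually (eventually_le_nhds hδ)] with t h1 h2 h3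
  exact h2.trans (add_le_add_left (coarseMass_le_rpow hα h1 h3) c)

/-- At fixed `δ` an interval of length `r ≤ δ` has coarse mass of order at most `r ^ α`. A jump of
`S` at `x` would be mass carried by arbitrarily short intervals ending or starting at `x`, and these
contribute nothing at any scale `δ`. Hence the one-sided limits, which exist by monotonicity, equal
`S x`. -/
theorem staircase_continuous (hα : 0 < α)
    (hfin : ∀ x y : ℝ, x ≤ y → fractalMass F α x y ≠ ⊤) : Continuous (staircase F α l) := by
  have hm := staircase_monotone (l := l) hα hfin
  set S := staircase F α l with hS
  have hsub : ∀ {x y}, x ≤ y → fractalMass F α x y = ENNReal.ofReal (S y - S x) :=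
    fun {x y} hxy => by rw [hS, staircase_sub hα hfin hxy, ENNReal.ofReal_toReal (hfin _ _ hxy)]
  refine continuous_iff_continuousAt.2 fun x => continuousAt_iff_continuous_left'_right'.2 ⟨?_, ?_⟩
  · have ht := hm.tendsto_nhdsLT x
    set s := sSup (S '' Set.Iio x)
    have hle : ∀ t < x, S t ≤ s := fun t htx =>
      le_csSup ⟨S x, by rintro _ ⟨w, hw, rfl⟩; exact hm (le_of_lt hw)⟩ ⟨t, htx, rfl⟩
    have hxs : fractalMass F α (x - 1) x ≤ ENNReal.ofReal (s - S (x - 1)) := by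
      refine fractalMass_le_of_eventually hα (p := 𝓝[<] x) (a := fun t => t) (b := fun _ => x)
        (eventually_mem_nhdsWithin.mono fun t (ht : t < x) => ht.le) ?_ fun δ hδ => ?_
      · have : Tendsto (fun t : ℝ => x - t) (𝓝 x) (𝓝 (x - x)) := tendsto_const_nhds.sub tendsto_id
        rw [sub_self] at this
        exact this.mono_left nhdsWithin_le_nhds
      · filter_upwards [eventually_mem_nhdsWithin,
          nhdsWithin_le_nhds (eventually_ge_nhds (sub_one_lt x))] with t (h1 : t < x) h2
        refine (coarseMass_le_add δ _ t _).trans ?_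
        rw [add_comm]
        refine add_le_add_right ((coarseMass_le_fractalMass hδ).trans ?_) _
        rw [hsub h2]
        exact ENNReal.ofReal_le_ofReal (by linarith [hle t h1])
    rw [hsub (by linarith)] at hxs
    have h2 : S (x - 1) ≤ s := hle _ (by linarith)
    rw [ENNReal.ofReal_le_ofReal_iff (by linarith)] at hxs
    have h3 : s = S x := le_antisymm
      (csSup_le ⟨_, x - 1, by simp, rfl⟩ (by rintro _ ⟨w, hw, rfl⟩; exact hm (le_of_lt hw)))
      (by linarith)
    rw [h3] at ht
    exact ht
  · have ht := hm.tendsto_nhdsGT x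
    set s := sInf (S '' Set.Ioi x)
    have hle : ∀ t > x, s ≤ S t := fun t htx =>
      csInf_le ⟨S x, by rintro _ ⟨w, hw, rfl⟩; exact hm (le_of_lt hw)⟩ ⟨t, htx, rfl⟩
    have hxs : fractalMass F α x (x + 1) ≤ ENNReal.ofReal (S (x + 1) - s) := by
      refine fractalMass_le_of_eventually hα (p := 𝓝[>] x) (a := fun _ => x) (b := fun t => t)
        (eventually_mem_nhdsWithin.mono fun t (ht : x < t) => ht.le) ?_ fun δ hδ => ?_
      · have : Tendsto (fun t : ℝ => t - x) (𝓝 x) (𝓝 (x - x)) := tendsto_id.sub tendsto_const_nhds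
        rw [sub_self] at this
        exact this.mono_left nhdsWithin_le_nhds
      · filter_upwards [eventually_mem_nhdsWithin,
          nhdsWithin_le_nhds (eventually_le_nhds (lt_add_one x))] with t (h1 : x < t) h2
        refine (coarseMass_le_add δ _ t _).trans ?_
        refine add_le_add_right ((coarseMass_le_fractalMass hδ).trans ?_) _
        rw [hsub h2]
        exact ENNReal.ofReal_le_ofReal (by linarith [hle t h1])
    rw [hsub (by linarith)] at hxs
    have h2 : s ≤ S (x + 1) := hle _ (by linarith)
    rw [ENNReal.ofReal_le_ofReal_iff (by linarith)] at hxs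
    have h3 : s = S x := le_antisymm (by linarith)
      (le_csInf ⟨_, x + 1, by simp, rfl⟩ (by rintro _ ⟨w, hw, rfl⟩; exact hm (le_of_lt hw)))
    rw [h3] at ht
    exact ht

end Staircase

/-! ### The right inverse of the staircase -/

/-- The properties of the staircase function of an `α`-perfect set that the calculus on the set
depends on, normalised at `0`. -/
structure IsStaircase (F : Set ℝ) (S : ℝ → ℝ) : Prop where
  mono : Monotone S
  cont : Continuous S
  flat : ∀ x y, x ≤ y → F ∩ Set.Icc x y = ∅ → S x = S y
  change : setOfChange S = F
  zero : S 0 = 0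
  top : Tendsto S atTop atTop

theorem IsAlphaPerfect.isStaircase {F : Set ℝ} {α l : ℝ} (hF : IsAlphaPerfect F α l) (hα : 0 < α)
    (h0 : staircase F α l 0 = 0) (htop : Tendsto (staircase F α l) atTop atTop) :
    IsStaircase F (staircase F α l) where
  mono := staircase_monotone hα hF.1
  cont := staircase_continuous hα hF.1
  flat _ _ := staircase_eq_of_inter_eq_empty hα hF.1
  change := hF.2
  zero := h0
  top := htop

/-- The largest point at which the function `S` takes the value `max u 0`. -/
noncomputable def levelMax (S : ℝ → ℝ) (u : ℝ) : ℝ := sSup {t | S t ≤ max u 0}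

namespace IsStaircase

variable {F : Set ℝ} {S : ℝ → ℝ}

theorem nonneg (hS : IsStaircase F S) {t : ℝ} (ht : 0 ≤ t) : 0 ≤ S t :=
  hS.zero.symm.le.trans (hS.mono ht)

theorem bddAbove_level (hS : IsStaircase F S) (u : ℝ) : BddAbove {t | S t ≤ u} := by
  obtain ⟨M, hM⟩ := (hS.top.eventually (eventually_gt_atTop u)).exists
  exact ⟨M, fun t ht => le_of_not_gt fun h =>
    absurd (hS.mono h.le) (not_le.2 (lt_of_le_of_lt ht hM))⟩

theorem le_levelMax (hS : IsStaircase F S) {t u : ℝ} (h : S t ≤ max u 0) : t ≤ levelMax S u :=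
  le_csSup (hS.bddAbove_level _) h

theorem levelMax_nonneg (hS : IsStaircase F S) (u : ℝ) : 0 ≤ levelMax S u :=
  hS.le_levelMax (by rw [hS.zero]; exact le_max_right _ _)

theorem apply_levelMax (hS : IsStaircase F S) (u : ℝ) : S (levelMax S u) = max u 0 := by
  have hne : {t | S t ≤ max u 0}.Nonempty := ⟨0, by simp [hS.zero]⟩
  apply le_antisymm
  · exact (isClosed_le hS.cont continuous_const).csSup_mem hne (hS.bddAbove_level _)
  · obtain ⟨M, hM⟩ := (hS.top.eventually (eventually_ge_atTop (max u 0))).exists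
    obtain ⟨t, ht⟩ := mem_range_of_exists_le_of_exists_ge hS.cont
      ⟨0, by rw [hS.zero]; exact le_max_right u 0⟩ ⟨M, hM⟩
    rw [← ht]
    exact hS.mono (hS.le_levelMax ht.le)

theorem apply_levelMax_of_nonneg (hS : IsStaircase F S) {u : ℝ} (hu : 0 ≤ u) :
    S (levelMax S u) = u := by
  rw [hS.apply_levelMax, max_eq_left hu]

theorem levelMax_mono (hS : IsStaircase F S) : Monotone (levelMax S) := fun u v huv =>
  hS.le_levelMax (by rw [hS.apply_levelMax]; exact max_le_max_right 0 huv)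

/-- Immediately to the right of the last point of its level, `S` is strictly larger, so that point
belongs to the set of change. -/
theorem levelMax_mem (hS : IsStaircase F S) (u : ℝ) : levelMax S u ∈ F := by
  rw [← hS.change]
  rintro c d hc hd ⟨k, hk⟩
  obtain ⟨t, ht, htd⟩ := exists_between hd
  have h1 := hk _ ⟨hc, hd⟩
  have h2 := hk t ⟨hc.trans ht, htd⟩
  exact absurd (hS.le_levelMax (u := u) (by rw [← hS.apply_levelMax, h1, h2])) (not_le.2 ht)

theorem levelMax_mem_Icc (hS : IsStaircase F S) {x y w : ℝ} (hx : 0 ≤ x)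
    (hw : w ∈ Set.Ico (S x) (S y)) : levelMax S w ∈ F ∩ Set.Icc x y := by
  have hw0 : 0 ≤ w := (hS.nonneg hx).trans hw.1
  refine ⟨hS.levelMax_mem w, hS.le_levelMax (by rw [max_eq_left hw0]; exact hw.1), ?_⟩
  refine le_of_not_gt fun h => ?_
  have := hS.mono h.le
  rw [hS.apply_levelMax_of_nonneg hw0] at this
  exact absurd hw.2 (not_lt.2 this)

/-- The filter is exactly the one in the fractal derivative at `levelMax S u`, so that difference
quotients can be composed with `levelMax S`. -/
theorem tendsto_levelMax_right (hS : IsStaircase F S) {u : ℝ} (hu : 0 ≤ u) :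
    Tendsto (levelMax S) (𝓝[>] u) (𝓝[(F ∩ Set.Ici 0) \ {levelMax S u}] (levelMax S u)) := by
  refine tendsto_nhdsWithin_iff.2 ⟨?_, ?_⟩
  · refine tendsto_order.2 ⟨fun a ha => ?_, fun a ha => ?_⟩
    · filter_upwards [eventually_mem_nhdsWithin] with w (hw : u < w)
      exact ha.trans_le (hS.levelMax_mono hw.le)
    · have hua : u < S a := by
        refine lt_of_not_ge fun h => absurd (hS.le_levelMax (u := u) ?_) (not_le.2 ha)
        rwa [max_eq_left hu]
      filter_upwards [nhdsWithin_le_nhds (eventually_lt_nhds hua),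
        eventually_mem_nhdsWithin] with w hw (hw' : u < w)
      refine lt_of_not_ge fun h => absurd (hS.mono h) (not_le.2 ?_)
      rwa [hS.apply_levelMax_of_nonneg (hu.trans hw'.le)]
  · filter_upwards [eventually_mem_nhdsWithin] with w (hw : u < w)
    refine ⟨⟨hS.levelMax_mem w, hS.levelMax_nonneg w⟩, fun h => hw.ne' ?_⟩
    rw [← hS.apply_levelMax_of_nonneg hu, ← hS.apply_levelMax_of_nonneg (hu.trans hw.le),
      Set.mem_singleton_iff.1 h]

/-- From the left, `levelMax S` converges to the first point `a` of the level set, which may lie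
strictly before the last one. It is in `F` because `S` takes values below `u` arbitrarily close to
its left. -/
theorem exists_tendsto_levelMax_left (hS : IsStaircase F S) {u : ℝ} (hu : 0 < u) :
    ∃ a ∈ F, 0 ≤ a ∧ S a = u ∧
      Tendsto (levelMax S) (𝓝[<] u) (𝓝[(F ∩ Set.Ici 0) \ {a}] a) := by
  have ht := hS.levelMax_mono.tendsto_nhdsLT u
  set a := sSup (levelMax S '' Set.Iio u)
  have hpos : ∀ᶠ w in 𝓝[<] u, 0 ≤ w ∧ w < u := by
    filter_upwards [nhdsWithin_le_nhds (eventually_ge_nhds hu), eventually_mem_nhdsWithin] with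
      w h1 h2 using ⟨h1, h2⟩
  have hSa : S a = u := by
    refine tendsto_nhds_unique ((hS.cont.tendsto a).comp ht) ?_
    have : Tendsto (fun w : ℝ => w) (𝓝[<] u) (𝓝 u) := tendsto_id.mono_left nhdsWithin_le_nhds
    exact this.congr' (hpos.mono fun w hw => (hS.apply_levelMax_of_nonneg hw.1).symm)
  have hne : ∀ w, 0 ≤ w → w < u → levelMax S w ≠ a := fun w h0 hw h => hw.ne (by
    rw [← hS.apply_levelMax_of_nonneg h0, h, hSa])
  refine ⟨a, ?_, ge_of_tendsto ht (Eventually.of_forall fun w => hS.levelMax_nonneg w), hSa, ?_⟩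
  · rw [← hS.change]
    rintro c d hc hd ⟨k, hk⟩
    obtain ⟨w, hw, hw'⟩ := (hpos.and (ht.eventually (Ioo_mem_nhds hc hd))).exists
    have h1 := hk _ hw'
    rw [hS.apply_levelMax_of_nonneg hw.1] at h1
    have h2 := hk a ⟨hc, hd⟩
    rw [hSa] at h2
    exact hw.2.ne (h1.trans h2.symm)
  · exact tendsto_nhdsWithin_iff.2 ⟨ht, hpos.mono fun w hw =>
      ⟨⟨hS.levelMax_mem w, hS.levelMax_nonneg w⟩, hne w hw.1 hw.2⟩⟩

theorem tendsto_levelMax_atTop (hS : IsStaircase F S) : Tendsto (levelMax S) atTop atTop := by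
  refine tendsto_atTop.2 fun M => ?_
  filter_upwards [eventually_ge_atTop (S M)] with u hu
  exact hS.le_levelMax (hu.trans (le_max_left _ _))

end IsStaircase

/-! ### Transport of the fractal derivative to the staircase variable -/

section Derivative

variable {F : Set ℝ} {α l : ℝ} {f : ℝ → ℝ}

/-- Since `S (levelMax S w) = w`, the slope of the composite between `u` and `w` is the fractal
difference quotient of `f` between the corresponding points of `F`. -/
theorem hasDerivWithinAt_comp_levelMax (hS : IsStaircase F (staircase F α l))
    (hfD : ∀ x ∈ F, 0 ≤ x → ∃ d, HasFractalDerivWithinAt F α l (Set.Ici 0) f d x)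
    {u : ℝ} (hu : 0 ≤ u) :
    HasDerivWithinAt (fun w => f (levelMax (staircase F α l) w))
      (fractalDerivWithin F α l (Set.Ici 0) f (levelMax (staircase F α l) u)) (Set.Ici u) u := by
  obtain ⟨d, hd⟩ := hfD _ (hS.levelMax_mem u) (hS.levelMax_nonneg u)
  have ht := hS.tendsto_levelMax_right hu
  -- The punctured filter is nontrivial at this point, so `limUnder` returns the limit `d`.
  have hne := ht.neBot
  have hval : fractalDerivWithin F α l (Set.Ici 0) f (levelMax (staircase F α l) u) = d := by
    rw [fractalDerivWithin, if_pos (hS.levelMax_mem u)]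
    exact Tendsto.limUnder_eq hd
  rw [hval, ← hasDerivWithinAt_Ioi_iff_Ici, hasDerivWithinAt_iff_tendsto_slope' (by simp)]
  refine (hd.comp ht).congr' ?_
  filter_upwards [eventually_mem_nhdsWithin] with w (hw : u < w)
  simp only [Function.comp, slope_def_field]
  rw [hS.apply_levelMax_of_nonneg hu, hS.apply_levelMax_of_nonneg (hu.trans hw.le)]

/-- Right continuity comes from the right derivative. Left continuity comes from differentiability
of `f` at the first point `a` of the level set, where `f` has the same value as at the last point
because it is a function of `S`. -/
theorem continuous_comp_levelMax (hS : IsStaircase F (staircase F α l))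
    (hfS : ∀ x y : ℝ, 0 ≤ x → 0 ≤ y → staircase F α l x = staircase F α l y → f x = f y)
    (hfD : ∀ x ∈ F, 0 ≤ x → ∃ d, HasFractalDerivWithinAt F α l (Set.Ici 0) f d x) :
    Continuous (fun u => f (levelMax (staircase F α l) u)) := by
  have hon : ContinuousOn (fun u => f (levelMax (staircase F α l) u)) (Set.Ici 0) := by
    intro u hu
    have hu : 0 ≤ u := hu
    refine ContinuousWithinAt.mono
      (t := Set.Ici u ∪ (if 0 < u then Set.Iic u else ∅)) ?_ fun w (hw : 0 ≤ w) => ?_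
    · refine ((hasDerivWithinAt_comp_levelMax hS hfD hu).continuousWithinAt).union ?_
      split_ifs with hpos
      · obtain ⟨a, haF, ha0, hSa, ht⟩ := hS.exists_tendsto_levelMax_left hpos
        obtain ⟨d, hd⟩ := hfD a haF ha0
        rw [← continuousWithinAt_Iio_iff_Iic]
        have h1 : Tendsto (fun y => staircase F α l y - staircase F α l a)
            (𝓝[(F ∩ Set.Ici 0) \ {a}] a) (𝓝 0) := by
          have : Tendsto (fun y => staircase F α l y - staircase F α l a) (𝓝 a) (𝓝 (_ - _)) :=
            (hS.cont.tendsto a).sub_const _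
          rw [sub_self] at this
          exact this.mono_left nhdsWithin_le_nhds
        have h2 := (hd.mul h1).add_const (f a)
        have h3 : Tendsto f (𝓝[(F ∩ Set.Ici 0) \ {a}] a) (𝓝 (f a)) := by
          rw [mul_zero, zero_add] at h2
          refine h2.congr' ?_
          filter_upwards [eventually_mem_nhdsWithin] with y hy
          -- Where the denominator vanishes the quotient has the default value `0`, and `f y = f a`
          -- follows from `hfS` instead.
          by_cases h : staircase F α l y - staircase F α l a = 0
          · rw [h, mul_zero, zero_add]
            exact hfS a y ha0 hy.1.2 (sub_eq_zero.1 h).symm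
          · rw [div_mul_cancel₀ _ h, sub_add_cancel]
        have h4 := h3.comp ht
        rw [hfS a _ ha0 (hS.levelMax_nonneg u)
          (by rw [hSa, hS.apply_levelMax_of_nonneg hu])] at h4
        exact h4
      · simp [ContinuousWithinAt]
    · split_ifs with hpos
      · exact le_total u w
      · obtain rfl : u = 0 := le_antisymm (not_lt.1 hpos) hu
        exact Or.inl hw
  -- `levelMax` truncates its argument at `0`, so the composite is constant on the negative axis and
  -- continuity on `[0, ∞)` extends to the line.
  have := hon.comp_continuous (f := fun u : ℝ => max u 0) (by fun_prop)
    (fun u => Set.mem_Ici.2 (le_max_right _ _))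
  refine this.congr fun u => ?_
  simp [levelMax]

end Derivative

/-! ### Lower sums and increments of functions with a right derivative -/

section Darboux

variable {F : Set ℝ} {S : ℝ → ℝ}

/-- The contribution of a single interval to a lower sum. -/
noncomputable def lowerPiece (F : Set ℝ) (S h : ℝ → ℝ) (x y : ℝ) : ℝ :=
  sInf (h '' (F ∩ Set.Icc x y)) * (S y - S x)

/-- This reduces upper sums to lower sums. Empty pieces agree, as `sSup ∅ = sInf ∅ = 0`. -/
theorem fractalUpperSum_eq_neg_sum {α l a b : ℝ} (h : ℝ → ℝ) (P : Subdivision a b) :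
    fractalUpperSum F α l h P = -P.sum (lowerPiece F (staircase F α l) (-h)) := by
  unfold fractalUpperSum Subdivision.sum lowerPiece
  rw [← Finset.sum_neg_distrib]
  refine Finset.sum_congr rfl fun i _ => ?_
  have : ∀ A : Set ℝ, sInf ((-h) '' A) = -sSup (h '' A) := fun A => by
    rw [Real.sInf_def, ← Set.image_neg_eq_neg, Set.image_image]
    simp
  rw [this]
  ring

namespace IsStaircase

/-- Mean value inequality with right derivatives, obtained by comparison with the line of slope `C`
through `(p, Ψ p)`. -/
theorem sub_le_mul {Ψ ψ : ℝ → ℝ} {C p q : ℝ} (hpq : p ≤ q) (hΨ : Continuous Ψ)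
    (hd : ∀ w ∈ Set.Ico p q, HasDerivWithinAt Ψ (ψ w) (Set.Ici w) w)
    (h : ∀ w ∈ Set.Ico p q, ψ w ≤ C) : Ψ q - Ψ p ≤ C * (q - p) := by
  have hB : ∀ x, HasDerivAt (fun w => Ψ p + C * (w - p)) C x := fun x => by
    simpa using (((hasDerivAt_id x).sub_const p).const_mul C).const_add (Ψ p)
  have := image_le_of_deriv_right_le_deriv_boundary (B := fun w => Ψ p + C * (w - p))
    (B' := fun _ => C) hΨ.continuousOn hd (by simp) (by fun_prop)
    (fun x _ => (hB x).hasDerivWithinAt) h (Set.right_mem_Icc.2 hpq)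
  linarith

theorem sub_le_lowerPiece (hS : IsStaircase F S) {x y C : ℝ} (hx : 0 ≤ x) (hxy : x ≤ y)
    {k Ψ ψ : ℝ → ℝ} (hΨ : Continuous Ψ)
    (hd : ∀ w, 0 ≤ w → HasDerivWithinAt Ψ (ψ w) (Set.Ici w) w)
    (h : ∀ w ∈ Set.Ico (S x) (S y), ∀ z ∈ F ∩ Set.Icc x y, ψ w ≤ k z + C) :
    Ψ (S y) - Ψ (S x) ≤ lowerPiece F S k x y + C * (S y - S x) := by
  rcases (F ∩ Set.Icc x y).eq_empty_or_nonempty with he | hne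
  · simp [lowerPiece, hS.flat x y hxy he]
  · rw [lowerPiece, ← add_mul]
    refine sub_le_mul (hS.mono hxy) hΨ (fun w hw => hd w ((hS.nonneg hx).trans hw.1)) ?_
    intro w hw
    rw [← sub_le_iff_le_add]
    refine le_csInf (hne.image k) ?_
    rintro _ ⟨z, hz, rfl⟩
    linarith [h w hw z hz]

/-- For each level `w` in `[S x, S y)` the point `levelMax S w` lies in `F ∩ [x, y]`, so the infimum
of `k` bounds the right derivative of `Ψ` from below. -/
theorem lowerPiece_le_sub (hS : IsStaircase F S) {x y : ℝ} (hx : 0 ≤ x) (hxy : x ≤ y)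
    {k Ψ : ℝ → ℝ} (hΨ : Continuous Ψ)
    (hd : ∀ w, 0 ≤ w → HasDerivWithinAt Ψ (k (levelMax S w)) (Set.Ici w) w)
    (hk : BddBelow (k '' (F ∩ Set.Icc x y))) :
    lowerPiece F S k x y ≤ Ψ (S y) - Ψ (S x) := by
  have := sub_le_mul (C := -sInf (k '' (F ∩ Set.Icc x y))) (hS.mono hxy) hΨ.neg
    (fun w hw => (hd w ((hS.nonneg hx).trans hw.1)).neg)
    (fun w hw => neg_le_neg (csInf_le hk ⟨_, hS.levelMax_mem_Icc hx hw, rfl⟩))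
  rw [lowerPiece]
  simp only [Pi.neg_apply] at this
  linarith

theorem sum_lowerPiece_le_sub (hS : IsStaircase F S) {a b : ℝ} (ha : 0 ≤ a)
    {k Ψ : ℝ → ℝ} (hΨ : Continuous Ψ)
    (hd : ∀ w, 0 ≤ w → HasDerivWithinAt Ψ (k (levelMax S w)) (Set.Ici w) w)
    (hk : BddBelow (k '' (F ∩ Set.Icc a b))) (P : Subdivision a b) :
    P.sum (lowerPiece F S k) ≤ Ψ (S b) - Ψ (S a) := by
  rw [← P.sum_sub (fun t => Ψ (S t))]
  refine P.sum_le_sum_of_le fun u v hu huv hv => hS.lowerPiece_le_sub (ha.trans hu) huv hΨ hd ?_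
  exact hk.mono (Set.image_mono (Set.inter_subset_inter_right _ (Set.Icc_subset_Icc hu hv)))

/-- On a fine subdivision the lower sum almost exceeds the increment of a function whose derivative
is locally almost below the integrand. -/
theorem exists_sub_le_sum_lowerPiece (hS : IsStaircase F S) {c d C δ : ℝ} (hc : 0 ≤ c)
    (hcd : c ≤ d) (hδ : 0 < δ) {k Ψ ψ : ℝ → ℝ} (hΨ : Continuous Ψ)
    (hd : ∀ w, 0 ≤ w → HasDerivWithinAt Ψ (ψ w) (Set.Ici w) w)
    (h : ∀ w ∈ Set.Ico (S c) (S d), ∀ z ∈ F ∩ Set.Icc c d, |levelMax S w - z| ≤ δ →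
      ψ w ≤ k z + C) :
    ∃ Q : Subdivision c d,
      Ψ (S d) - Ψ (S c) - C * (S d - S c) ≤ Q.sum (lowerPiece F S k) := by
  obtain ⟨Q, hQ⟩ := Subdivision.exists_meshLE hcd hδ
  refine ⟨Q, ?_⟩
  -- Telescoping this function spreads the left side over the pieces of `Q`.
  have := Q.sum_sub (fun t => Ψ (S t) - C * S t)
  have e : Ψ (S d) - Ψ (S c) - C * (S d - S c)
    = Q.sum fun u v => Ψ (S v) - C * S v - (Ψ (S u) - C * S u) := by rw [this]; ring
  rw [e]
  refine Finset.sum_le_sum fun i hi => ?_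
  have hi := Finset.mem_range.1 hi
  have h1 := Q.le_pt hi.le
  have h2 := Q.pt_le (i := i + 1) hi
  have := hS.sub_le_lowerPiece (C := C) (k := k) (hc.trans h1) (Q.mono i hi) hΨ hd ?_
  · linarith
  · intro w hw z hz
    have hm := hS.levelMax_mem_Icc (hc.trans h1) hw
    refine h w ⟨(hS.mono h1).trans hw.1, hw.2.trans_le (hS.mono h2)⟩ z
      ⟨hz.1, h1.trans hz.2.1, hz.2.2.trans h2⟩ ?_
    have := hQ i hi
    have := hm.2.1
    have := hm.2.2
    have := hz.2.1
    have := hz.2.2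
    rw [abs_le]
    constructor <;> linarith

theorem exists_forall_abs_sub_le (hS : IsStaircase F S) {φ : ℝ → ℝ} (hφ : Continuous φ)
    (a b : ℝ) {η : ℝ} (hη : 0 < η) : ∃ δ > 0, ∀ x ∈ Set.Icc a b, ∀ y ∈ Set.Icc a b,
      |x - y| ≤ δ → |φ (S x) - φ (S y)| ≤ η := by
  have := (isCompact_Icc (a := a) (b := b)).uniformContinuousOn_of_continuous
    (hφ.comp hS.cont).continuousOn
  obtain ⟨δ, hδ, h⟩ := Metric.uniformContinuousOn_iff_le.1 this η hη
  exact ⟨δ, hδ, h⟩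

/-- On a mesh below the modulus of continuity of `φ ∘ S`, each lower piece falls short of the
increment of `Φ` by at most `η` times the increment of `S`. -/
theorem isLUB_sum_lowerPiece_continuous (hS : IsStaircase F S) {a b : ℝ} (ha : 0 ≤ a)
    (hab : a ≤ b) {k φ Φ : ℝ → ℝ} (hφ : Continuous φ) (hΦ : ∀ w, HasDerivAt Φ (φ w) w)
    (hk : ∀ t ∈ Set.Icc a b, k t = φ (S t)) :
    IsLUB (Set.range fun P : Subdivision a b => P.sum (lowerPiece F S k))
      (Φ (S b) - Φ (S a)) := by
  have hΦc : Continuous Φ := continuous_iff_continuousAt.2 fun w => (hΦ w).continuousAt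
  constructor
  · rintro _ ⟨P, rfl⟩
    have hle := hS.sum_lowerPiece_le_sub ha (k := fun t => φ (S t)) hΦc
      (fun w hw => by
        rw [hS.apply_levelMax_of_nonneg hw]
        exact (hΦ w).hasDerivWithinAt)
      (((isCompact_Icc (a := a) (b := b)).bddBelow_image
        (hφ.comp hS.cont).continuousOn).mono (Set.image_mono Set.inter_subset_right)) P
    refine le_trans (P.sum_le_sum_of_le fun u v hu huv hv => le_of_eq ?_) hle
    unfold lowerPiece
    rw [Set.image_congr fun t ht => hk t ⟨hu.trans ht.2.1, ht.2.2.trans hv⟩]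
  · intro J hJ
    refine le_of_forall_pos_le_add fun ε hε => ?_
    have hD : 0 ≤ S b - S a := sub_nonneg.2 (hS.mono hab)
    set η := ε / (S b - S a + 1)
    have hη : 0 < η := by positivity
    obtain ⟨δ, hδ, hu⟩ := hS.exists_forall_abs_sub_le hφ a b hη
    obtain ⟨Q, hQ⟩ := hS.exists_sub_le_sum_lowerPiece (C := η) (k := k) ha hab hδ hΦc
      (fun w _ => (hΦ w).hasDerivWithinAt) (fun w hw z hz hwz => by
        have := hu _ (hS.levelMax_mem_Icc ha hw).2 z hz.2 hwz
        rw [hS.apply_levelMax_of_nonneg ((hS.nonneg ha).trans hw.1)] at this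
        rw [hk z hz.2]
        linarith [(abs_le.1 this).2])
    have h1 := hJ ⟨Q, rfl⟩
    simp only at h1
    have h2 : η * (S b - S a) ≤ ε := by
      rw [div_mul_eq_mul_div, div_le_iff₀ (by positivity)]
      nlinarith
    linarith

/-- If the lower sums of `h` exhaust the increment of `g`, then those of the product with a
nonnegative continuous function of the staircase exhaust the increment of `Φ`. -/
theorem isLUB_sum_lowerPiece_mul (hS : IsStaircase F S) {a b B : ℝ} (ha : 0 ≤ a)
    (hab : a ≤ b) {h g φ Φ : ℝ → ℝ} (hφ : Continuous φ) (hφ0 : ∀ w, 0 ≤ φ w)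
    (hg : Continuous g) (hgd : ∀ w, 0 ≤ w → HasDerivWithinAt g (h (levelMax S w)) (Set.Ici w) w)
    (hΦ : Continuous Φ)
    (hΦd : ∀ w, 0 ≤ w → HasDerivWithinAt Φ (φ w * h (levelMax S w)) (Set.Ici w) w)
    (hB : ∀ t ∈ F ∩ Set.Icc a b, |h t| ≤ B)
    (hLUB : IsLUB (Set.range fun P : Subdivision a b => P.sum (lowerPiece F S h))
      (g (S b) - g (S a))) :
    IsLUB (Set.range fun P : Subdivision a b => P.sum (lowerPiece F S fun t => φ (S t) * h t))
      (Φ (S b) - Φ (S a)) := by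
  obtain ⟨E, hE⟩ := (isCompact_Icc (a := a) (b := b)).bddAbove_image
    (hφ.comp hS.cont).continuousOn
  have hE : ∀ t ∈ Set.Icc a b, φ (S t) ≤ E := fun t ht => hE ⟨t, ht, rfl⟩
  have hE0 : 0 ≤ E := (hφ0 _).trans (hE a ⟨le_rfl, hab⟩)
  -- `F ∩ [a, b]` may be empty, in which case `hB` does not force `B ≥ 0`.
  wlog hB0 : 0 ≤ B generalizing B
  · exact this (B := max B 0) (fun t ht => (hB t ht).trans (le_max_left _ _)) (le_max_right _ _)
  constructor
  · rintro _ ⟨P, rfl⟩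
    refine hS.sum_lowerPiece_le_sub ha hΦ (fun w hw => ?_) ?_ P
    · simpa only [hS.apply_levelMax_of_nonneg hw] using hΦd w hw
    · refine ⟨-(E * B), ?_⟩
      rintro _ ⟨t, ht, rfl⟩
      have h1 : |φ (S t) * h t| ≤ E * B := by
        rw [abs_mul, abs_of_nonneg (hφ0 _)]
        exact mul_le_mul (hE t ht.2) (hB t ht) (abs_nonneg _) hE0
      exact (abs_le.1 h1).1
  · intro J hJ
    refine le_of_forall_pos_le_add fun ε hε => ?_
    have hD : 0 ≤ S b - S a := sub_nonneg.2 (hS.mono hab)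
    -- Half of `ε` pays for the oscillation of `φ ∘ S`, the other half for the defect `ε'` of the
    -- lower sum of `h`, magnified by `E`. The summands `1` keep the denominators positive.
    set η := ε / 2 / (B * (S b - S a) + 1)
    have hη : 0 < η := by positivity
    have hη' : η * B * (S b - S a) ≤ ε / 2 := by
      rw [mul_assoc, div_mul_eq_mul_div, div_le_iff₀ (by positivity)]
      nlinarith [mul_nonneg hB0 hD]
    set ε' := ε / 2 / (E + 1)
    have hε' : 0 < ε' := by positivity
    have hε'' : E * ε' ≤ ε / 2 := by
      rw [mul_div_assoc', div_le_iff₀ (by positivity)]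
      nlinarith
    obtain ⟨δ, hδ, hu⟩ := hS.exists_forall_abs_sub_le hφ a b hη
    obtain ⟨_, ⟨P, rfl⟩, hP, -⟩ := hLUB.exists_between (sub_lt_self _ hε')
    simp only at hP
    -- Subtracting `E * g` makes the weight `φ - E` nonpositive, so a lower bound for `h` gives an
    -- upper bound for the right derivative. The term `E * lowerPiece` puts `E * g` back up to the
    -- defect of `P`.
    set T : ℝ → ℝ := fun t => Φ (S t) - E * g (S t) - η * B * S t with hT
    have hpiece : ∀ u v, a ≤ u → u ≤ v → v ≤ b → ∃ Q : Subdivision u v,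
        (T v - T u) + E * lowerPiece F S h u v ≤
          Q.sum (lowerPiece F S fun t => φ (S t) * h t) := by
      intro c d hac hcd hdb
      have hsub : ∀ {t}, t ∈ Set.Icc c d → t ∈ Set.Icc a b :=
        fun ht => ⟨hac.trans ht.1, ht.2.trans hdb⟩
      set m := sInf (h '' (F ∩ Set.Icc c d)) with hm
      have hbdd : BddBelow (h '' (F ∩ Set.Icc c d)) := by
        refine ⟨-B, ?_⟩
        rintro _ ⟨t, ht, rfl⟩
        exact (abs_le.1 (hB t ⟨ht.1, hsub ht.2⟩)).1
      -- With `m` the infimum over the whole coarse piece: `(φ w - E) * h ≤ (φ w - E) * m`, then `φ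
      -- w * m ≤ φ (S z) * m + η * B`, then `m ≤ h z`. Only `φ ∘ S` needs the fine mesh, as `h` may
      -- oscillate.
      have hloc : ∀ w ∈ Set.Ico (S c) (S d), ∀ z ∈ F ∩ Set.Icc c d, |levelMax S w - z| ≤ δ →
          φ w * h (levelMax S w) - E * h (levelMax S w) ≤ φ (S z) * h z + (η * B - E * m) := by
        intro w hw z hz hwz
        have hβ := hS.levelMax_mem_Icc (ha.trans hac) hw
        have h1 := hu _ (hsub hβ.2) z (hsub hz.2) hwz
        have h2 := hE _ (hsub hβ.2)
        rw [hS.apply_levelMax_of_nonneg ((hS.nonneg (ha.trans hac)).trans hw.1)] at h1 h2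
        have h3 : m ≤ h (levelMax S w) := csInf_le hbdd ⟨_, hβ, rfl⟩
        have h4 : m ≤ h z := csInf_le hbdd ⟨_, hz, rfl⟩
        have h5 : |m| ≤ B := by
          refine abs_le.2 ⟨le_csInf ⟨_, z, hz, rfl⟩ ?_,
            h4.trans (abs_le.1 (hB z ⟨hz.1, hsub hz.2⟩)).2⟩
          rintro _ ⟨t, ht, rfl⟩
          exact (abs_le.1 (hB t ⟨ht.1, hsub ht.2⟩)).1
        have h6 : (φ w - φ (S z)) * m ≤ η * B :=
          (le_abs_self _).trans (by rw [abs_mul]; exact mul_le_mul h1 h5 (abs_nonneg _) hη.le)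
        have h7 := mul_le_mul_of_nonneg_left h4 (hφ0 (S z))
        have h8 := mul_le_mul_of_nonneg_left h3 (sub_nonneg.2 h2)
        linarith
      obtain ⟨Q, hQ⟩ := hS.exists_sub_le_sum_lowerPiece (C := η * B - E * m)
        (k := fun t => φ (S t) * h t) (Ψ := fun w => Φ w - E * g w)
        (ψ := fun w => φ w * h (levelMax S w) - E * h (levelMax S w))
        (ha.trans hac) hcd hδ (by fun_prop)
        (fun w hw => (hΦd w hw).sub ((hgd w hw).const_mul E)) hloc
      refine ⟨Q, le_trans (le_of_eq ?_) hQ⟩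
      simp only [hT, lowerPiece, ← hm]
      ring
    obtain ⟨Q, hQ⟩ := P.exists_glue _ _ hpiece
    have h1 := hJ ⟨Q, rfl⟩
    simp only at h1
    have h2 : P.sum (fun u v => (T v - T u) + E * lowerPiece F S h u v) =
        T b - T a + E * P.sum (lowerPiece F S h) := by
      rw [← P.sum_sub T]
      simp only [Subdivision.sum, Finset.sum_add_distrib, Finset.mul_sum]
    rw [h2] at hQ
    have h3 := mul_le_mul_of_nonneg_left hP.le hE0
    simp only [hT] at hQ
    linarith

end IsStaircase

end Darboux

/-! ### Fractal integrals as increments in the staircase variable -/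

section Integral

variable {F : Set ℝ} {α l : ℝ}

theorem fractalIntegrable_of_isLUB {a b J : ℝ} (hab : a ≤ b) {k : ℝ → ℝ} {B : ℝ}
    (hB : ∀ t ∈ F ∩ Set.Icc a b, |k t| ≤ B)
    (h1 : IsLUB (Set.range fun P : Subdivision a b =>
      P.sum (lowerPiece F (staircase F α l) k)) J)
    (h2 : IsLUB (Set.range fun P : Subdivision a b =>
      P.sum (lowerPiece F (staircase F α l) (-k))) (-J)) :
    FractalIntegrable F α l k a b ∧ fractalIntegral F α l k a b = J := by
  have : Nonempty (Subdivision a b) := ⟨Subdivision.single a b hab⟩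
  have e1 : (⨆ P : Subdivision a b, fractalLowerSum F α l k P) = J := h1.ciSup_eq
  have e2 : (⨅ P : Subdivision a b, fractalUpperSum F α l k P) = J := by
    simp only [fractalUpperSum_eq_neg_sum]
    refine IsGLB.ciInf_eq ?_
    have := h2.neg
    rw [neg_neg, ← Set.image_neg_eq_neg, ← Set.range_comp] at this
    exact this
  refine ⟨⟨⟨B, ?_⟩, ⟨-B, ?_⟩, e1.trans e2.symm⟩, e1⟩ <;> rintro _ ⟨t, ht, rfl⟩
  · exact (abs_le.1 (hB t ht)).2
  · exact (abs_le.1 (hB t ht)).1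

theorem fractalIntegrable_of_eq_comp_staircase (hS : IsStaircase F (staircase F α l)) {a b : ℝ}
    (ha : 0 ≤ a) (hab : a ≤ b) {k φ : ℝ → ℝ} (hφ : Continuous φ)
    (hk : ∀ t ∈ Set.Icc a b, k t = φ (staircase F α l t)) :
    FractalIntegrable F α l k a b ∧
      fractalIntegral F α l k a b = ∫ u in (staircase F α l a)..(staircase F α l b), φ u := by
  obtain ⟨B, hB⟩ := (isCompact_Icc (a := a) (b := b)).exists_bound_of_continuousOn
    (hφ.comp hS.cont).continuousOn
  have hd : ∀ w, HasDerivAt (fun u => ∫ v in (0 : ℝ)..u, φ v) (φ w) w :=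
    fun w => hφ.integral_hasStrictDerivAt 0 w |>.hasDerivAt
  have e : ∀ p q, (∫ u in p..q, φ u) = (∫ u in (0 : ℝ)..q, φ u) - ∫ u in (0 : ℝ)..p, φ u :=
    fun p q => (intervalIntegral.integral_interval_sub_left (hφ.intervalIntegrable _ _)
      (hφ.intervalIntegrable _ _)).symm
  rw [e]
  refine fractalIntegrable_of_isLUB hab (B := B) (fun t ht => ?_) ?_ ?_
  · rw [hk t ht.2]
    exact hB t ht.2
  · exact hS.isLUB_sum_lowerPiece_continuous ha hab hφ hd hk
  · have := hS.isLUB_sum_lowerPiece_continuous ha hab hφ.neg (fun w => (hd w).neg)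
      (k := -k) (fun t ht => by simp [hk t ht])
    convert this using 1
    simp only [Pi.neg_apply]
    ring

theorem FractalIntegrable.exists_bound {a b : ℝ} {h : ℝ → ℝ} (hi : FractalIntegrable F α l h a b) :
    ∃ B, ∀ t ∈ F ∩ Set.Icc a b, |h t| ≤ B := by
  obtain ⟨⟨B, hB⟩, ⟨C, hC⟩, -⟩ := hi
  refine ⟨max B (-C), fun t ht => abs_le.2 ⟨?_, ?_⟩⟩
  · have := hC ⟨t, ht, rfl⟩
    linarith [le_max_right B (-C)]
  · exact (hB ⟨t, ht, rfl⟩).trans (le_max_left _ _)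

/-- Every lower sum of `h` is at most the increment of `g` and every upper sum at least that, so
integrability makes both extrema equal to it. The weighted lower sum result then applies to `h` and
to `-h`. -/
theorem fractalIntegrable_mul (hS : IsStaircase F (staircase F α l)) {a b : ℝ}
    (ha : 0 ≤ a) (hab : a ≤ b) {h g φ Φ : ℝ → ℝ} (hφ : Continuous φ) (hφ0 : ∀ w, 0 ≤ φ w)
    (hg : Continuous g)
    (hgd : ∀ w, 0 ≤ w →
      HasDerivWithinAt g (h (levelMax (staircase F α l) w)) (Set.Ici w) w)
    (hΦ : Continuous Φ)
    (hΦd : ∀ w, 0 ≤ w →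
      HasDerivWithinAt Φ (φ w * h (levelMax (staircase F α l) w)) (Set.Ici w) w)
    (hi : FractalIntegrable F α l h a b) :
    FractalIntegrable F α l (fun t => φ (staircase F α l t) * h t) a b ∧
      fractalIntegral F α l (fun t => φ (staircase F α l t) * h t) a b =
        Φ (staircase F α l b) - Φ (staircase F α l a) := by
  have hne : Nonempty (Subdivision a b) := ⟨Subdivision.single a b hab⟩
  obtain ⟨B, hB⟩ := hi.exists_bound
  obtain ⟨E, hE⟩ := (isCompact_Icc (a := a) (b := b)).bddAbove_image
    (hφ.comp hS.cont).continuousOn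
  have hlow := hS.sum_lowerPiece_le_sub (b := b) ha hg hgd hi.2.1
  have hup : ∀ P : Subdivision a b, _ := hS.sum_lowerPiece_le_sub (k := -h) (b := b) ha hg.neg
    (fun w hw => (hgd w hw).neg) ⟨-B, by
      rintro _ ⟨t, ht, rfl⟩
      exact neg_le_neg ((le_abs_self _).trans (hB t ht))⟩
  simp only [Pi.neg_apply] at hup
  have hbl : BddAbove (Set.range fun P : Subdivision a b => fractalLowerSum F α l h P) :=
    ⟨_, by rintro _ ⟨P, rfl⟩; exact hlow P⟩
  have hup' : ∀ P : Subdivision a b, g (staircase F α l b) - g (staircase F α l a) ≤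
      fractalUpperSum F α l h P := fun P => by
    rw [fractalUpperSum_eq_neg_sum]
    linarith [hup P]
  have hbu : BddBelow (Set.range fun P : Subdivision a b => fractalUpperSum F α l h P) :=
    ⟨_, by rintro _ ⟨P, rfl⟩; exact hup' P⟩
  have h1 := isLUB_ciSup hbl
  have h2 := isGLB_ciInf hbu
  have e1 : (⨆ P : Subdivision a b, fractalLowerSum F α l h P) =
      g (staircase F α l b) - g (staircase F α l a) :=
    le_antisymm (ciSup_le hlow) (by rw [hi.2.2]; exact le_ciInf hup')
  rw [← hi.2.2, e1] at h2
  rw [e1] at h1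
  have h3 := h2.neg
  rw [← Set.image_neg_eq_neg, ← Set.range_comp] at h3
  have e3 : (Neg.neg ∘ fun P : Subdivision a b => fractalUpperSum F α l h P) =
      fun P => P.sum (lowerPiece F (staircase F α l) (-h)) := by
    funext P
    simp [fractalUpperSum_eq_neg_sum]
  rw [e3] at h3
  refine fractalIntegrable_of_isLUB hab (B := E * B) (fun t ht => ?_) ?_ ?_
  · rw [abs_mul, abs_of_nonneg (hφ0 _)]
    have h4 : φ (staircase F α l t) ≤ E := hE ⟨t, ht.2, rfl⟩
    exact mul_le_mul h4 (hB t ht) (abs_nonneg _) ((hφ0 _).trans h4)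
  · exact hS.isLUB_sum_lowerPiece_mul ha hab hφ hφ0 hg hgd hΦ hΦd hB h1
  · have := hS.isLUB_sum_lowerPiece_mul (h := -h) (B := B) (Φ := -Φ) (g := -g) ha hab hφ hφ0 hg.neg
      (fun w hw => (hgd w hw).neg) hΦ.neg
      (fun w hw => by simpa using (hΦd w hw).neg)
      (fun t ht => by simpa using hB t ht) (by
        have e5 : (-g) (staircase F α l b) - (-g) (staircase F α l a) =
            -(g (staircase F α l b) - g (staircase F α l a)) := by
          simp only [Pi.neg_apply]
          ring
        rw [e5]
        exact h3)
    convert this using 1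
    · have e4 : (-fun t => φ (staircase F α l t) * h t) =
          fun t => φ (staircase F α l t) * (-h) t := by
        funext t
        simp
      rw [e4]
    · simp only [Pi.neg_apply]
      ring

end Integral

/-! ### Abel averaging and the Laplace integral of the relaxation -/

section LaplaceAnalysis

variable {g A : ℝ → ℝ}

/-- Exponentially weighted averages of a convergent function converge to the same limit. -/
theorem tendsto_exp_neg_mul_integral_exp_mul {p L : ℝ} (hp : 0 < p) (hA : Continuous A)
    (hL : Tendsto A atTop (𝓝 L)) :
    Tendsto (fun U => p * (Real.exp (-(p * U)) * ∫ w in (0 : ℝ)..U, Real.exp (p * w) * A w)) atTop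
      (𝓝 L) := by
  have hexp : ∀ a b : ℝ, ∫ w in a..b, Real.exp (p * w) =
      (Real.exp (p * b) - Real.exp (p * a)) / p := fun a b => by
    rw [intervalIntegral.integral_comp_mul_left (fun x => Real.exp x) hp.ne', integral_exp,
      smul_eq_mul, inv_mul_eq_div]
  have hdecay : Tendsto (fun U => Real.exp (-(p * U))) atTop (𝓝 0) :=
    Real.tendsto_exp_neg_atTop_nhds_zero.comp (tendsto_id.const_mul_atTop hp)
  have hci : ∀ a b : ℝ, IntervalIntegrable (fun w => Real.exp (p * w) * A w)
      MeasureTheory.volume a b := fun a b => (by fun_prop : Continuous _).intervalIntegrable a b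
  have hdi : ∀ a b : ℝ, IntervalIntegrable (fun w => Real.exp (p * w) * (A w - L))
      MeasureTheory.volume a b := fun a b => (by fun_prop : Continuous _).intervalIntegrable a b
  rw [Metric.tendsto_atTop']
  intro ε hε
  obtain ⟨M, hM⟩ := Metric.tendsto_atTop.1 hL (ε / 2) (by positivity)
  -- This bounds everything multiplied by the decaying factor alone: the initial segment `[0, M]`,
  -- and the defect `L` left because the weights on `[0, U]` have total mass `1 - e^(-p U)`.
  set c := p * |∫ w in (0 : ℝ)..M, Real.exp (p * w) * (A w - L)| + |L| + 1
  have hc : 0 < c := by positivity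
  obtain ⟨M', hM'⟩ := Metric.tendsto_atTop.1 hdecay (ε / 2 / c) (by positivity)
  refine ⟨max M M', fun U hU => ?_⟩
  have h1 : M < U := (le_max_left _ _).trans_lt hU
  have h2 := hM' U ((le_max_right _ _).trans hU.le)
  rw [Real.dist_eq, sub_zero, abs_of_pos (Real.exp_pos _), lt_div_iff₀ hc] at h2
  set D := Real.exp (-(p * U)) with hD
  have hD0 : 0 < D := Real.exp_pos _
  have hDU : D * Real.exp (p * U) = 1 := by rw [hD, ← Real.exp_add]; simp
  have hsplit : ∫ w in (0 : ℝ)..U, Real.exp (p * w) * A w =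
      (∫ w in (0 : ℝ)..M, Real.exp (p * w) * (A w - L)) +
        (∫ w in M..U, Real.exp (p * w) * (A w - L)) + (Real.exp (p * U) - 1) / p * L := by
    rw [intervalIntegral.integral_add_adjacent_intervals (hdi _ _) (hdi _ _)]
    have : (Real.exp (p * U) - 1) / p * L = ∫ w in (0 : ℝ)..U, Real.exp (p * w) * L := by
      rw [intervalIntegral.integral_mul_const, hexp]
      simp
    rw [this, ← intervalIntegral.integral_add (hdi _ _)
      ((by fun_prop : Continuous fun w => Real.exp (p * w) * L).intervalIntegrable _ _)]
    congr 1
    funext w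
    ring
  have htail : |∫ w in M..U, Real.exp (p * w) * (A w - L)| ≤ Real.exp (p * U) / p * (ε / 2) := by
    calc |∫ w in M..U, Real.exp (p * w) * (A w - L)|
        ≤ ∫ w in M..U, Real.exp (p * w) * (ε / 2) := by
          rw [← Real.norm_eq_abs]
          refine intervalIntegral.norm_integral_le_of_norm_le h1.le
            (MeasureTheory.ae_of_all _ fun w hw => ?_)
            ((by fun_prop : Continuous fun w => Real.exp (p * w) * (ε / 2)).intervalIntegrable _ _)
          rw [norm_mul, Real.norm_of_nonneg (Real.exp_pos _).le]
          exact mul_le_mul_of_nonneg_left (hM w hw.1.le).le (Real.exp_pos _).le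
      _ ≤ _ := by
          rw [intervalIntegral.integral_mul_const, hexp]
          gcongr
          linarith [Real.exp_pos (p * M)]
  rw [Real.dist_eq, hsplit]
  set I₁ := ∫ w in (0 : ℝ)..M, Real.exp (p * w) * (A w - L)
  set I₂ := ∫ w in M..U, Real.exp (p * w) * (A w - L)
  have e : p * (D * (I₁ + I₂ + (Real.exp (p * U) - 1) / p * L)) - L =
      D * (p * I₁ - L) + p * D * I₂ := by
    have : p * (D * (I₁ + I₂ + (Real.exp (p * U) - 1) / p * L)) - L =
      D * (p * I₁ - L) + p * D * I₂ + (D * Real.exp (p * U) - 1) * L := by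
      field_simp
      ring
    rw [this, hDU]
    ring
  rw [e]
  have h3 : |D * (p * I₁ - L)| ≤ D * c := by
    rw [abs_mul, abs_of_pos hD0]
    refine mul_le_mul_of_nonneg_left ?_ hD0.le
    have := abs_sub (p * I₁) L
    rw [abs_mul, abs_of_pos hp] at this
    linarith
  have h4 : |p * D * I₂| ≤ ε / 2 := by
    rw [abs_mul, abs_of_pos (by positivity)]
    calc p * D * |I₂| ≤ p * D * (Real.exp (p * U) / p * (ε / 2)) := by gcongr
      _ = D * Real.exp (p * U) * (ε / 2) := by field_simp
      _ = ε / 2 := by rw [hDU, one_mul]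
  have := abs_add_le (D * (p * I₁ - L)) (p * D * I₂)
  linarith

theorem hasDerivAt_integral_zero {k : ℝ → ℝ} (hk : Continuous k) (u : ℝ) :
    HasDerivAt (fun U => ∫ w in (0 : ℝ)..U, k w) (k u) u :=
  (hk.integral_hasStrictDerivAt 0 u).hasDerivAt

theorem hasDerivAt_exp_mul (c u : ℝ) :
    HasDerivAt (fun w => Real.exp (c * w)) (c * Real.exp (c * u)) u := by
  simpa [mul_comm] using ((hasDerivAt_id u).const_mul c).exp

/-- The solution of `G' = g' - κ G`, `G 0 = 0`, in integrated form. -/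
noncomputable def relaxation (κ : ℝ) (g : ℝ → ℝ) (u : ℝ) : ℝ :=
  g u - Real.exp (-κ * u) * g 0 -
    κ * (Real.exp (-κ * u) * ∫ w in (0 : ℝ)..u, Real.exp (κ * w) * g w)

theorem continuous_relaxation (κ : ℝ) (hg : Continuous g) : Continuous (relaxation κ g) := by
  have h : Continuous fun u => ∫ w in (0 : ℝ)..u, Real.exp (κ * w) * g w :=
    continuous_iff_continuousAt.2 fun u =>
      (hasDerivAt_integral_zero (by fun_prop) u).continuousAt
  unfold relaxation
  fun_prop

/-- Exchanging the order in the double integral leaves, besides terms with evident limits, only the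
boundary term `e^(-p U) K U`. It tends to `0` because it is the difference between `A U` and an
exponential average of `A`. -/
theorem tendsto_integral_exp_mul_relaxation {s κ L : ℝ} (hp : 0 < s + κ) (hg : Continuous g)
    (hL : Tendsto (fun U => ∫ u in (0 : ℝ)..U, Real.exp (-s * u) * g u) atTop (𝓝 L)) :
    Tendsto (fun U => ∫ u in (0 : ℝ)..U, Real.exp (-s * u) * relaxation κ g u) atTop
      (𝓝 ((s * L - g 0) / (s + κ))) := by
  set p := s + κ with hpdef
  set A : ℝ → ℝ := fun U => ∫ u in (0 : ℝ)..U, Real.exp (-s * u) * g u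
  set K : ℝ → ℝ := fun U => ∫ u in (0 : ℝ)..U, Real.exp (κ * u) * g u with hK
  have hA' : ∀ u, HasDerivAt A (Real.exp (-s * u) * g u) u :=
    hasDerivAt_integral_zero (by fun_prop)
  have hK' : ∀ u, HasDerivAt K (Real.exp (κ * u) * g u) u :=
    hasDerivAt_integral_zero (by fun_prop)
  have hA : Continuous A := continuous_iff_continuousAt.2 fun u => (hA' u).continuousAt
  have hA0 : A 0 = 0 := intervalIntegral.integral_same
  have hK0 : K 0 = 0 := intervalIntegral.integral_same
  -- Integration by parts, from `K' = e^(p u) A'`.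
  have hKA : ∀ U, K U = Real.exp (p * U) * A U - p * ∫ w in (0 : ℝ)..U, Real.exp (p * w) * A w := by
    intro U
    have hd : ∀ u, HasDerivAt (fun U => Real.exp (p * U) * A U -
        p * ∫ w in (0 : ℝ)..U, Real.exp (p * w) * A w) (Real.exp (κ * u) * g u) u := fun u => by
      refine (((hasDerivAt_exp_mul p u).mul (hA' u)).sub
        ((hasDerivAt_integral_zero (by fun_prop) u).const_mul p)).congr_deriv ?_
      have : Real.exp (κ * u) = Real.exp (p * u) * Real.exp (-s * u) := by
        rw [← Real.exp_add]; congr 1; rw [hpdef]; ring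
      rw [this]
      ring
    have := intervalIntegral.integral_eq_sub_of_hasDerivAt (a := 0) (b := U) (fun u _ => hd u)
      ((by fun_prop : Continuous fun u => Real.exp (κ * u) * g u).intervalIntegrable _ _)
    simp only [hK]
    rw [this]
    simp [hA0]
  have hdecay : Tendsto (fun U => Real.exp (-(p * U))) atTop (𝓝 0) :=
    Real.tendsto_exp_neg_atTop_nhds_zero.comp (tendsto_id.const_mul_atTop hp)
  have hKlim : Tendsto (fun U => Real.exp (-(p * U)) * K U) atTop (𝓝 0) := by
    have := hL.sub (tendsto_exp_neg_mul_integral_exp_mul hp hA hL)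
    rw [sub_self] at this
    refine this.congr fun U => ?_
    rw [hKA U]
    have hDU : Real.exp (-(p * U)) * Real.exp (p * U) = 1 := by rw [← Real.exp_add]; simp
    linear_combination -(A U) * hDU
  -- Both sides vanish at `0` and have the same derivative.
  have hY : ∀ U, (∫ u in (0 : ℝ)..U, Real.exp (-s * u) * relaxation κ g u) =
      A U - g 0 * (1 - Real.exp (-(p * U))) / p - κ * (A U - Real.exp (-(p * U)) * K U) / p := by
    intro U
    have hE : ∀ u, HasDerivAt (fun U => Real.exp (-(p * U))) (-p * Real.exp (-(p * u))) u :=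
      fun u => by simpa [neg_mul] using hasDerivAt_exp_mul (-p) u
    have hd : ∀ u, HasDerivAt (fun U => A U - g 0 * (1 - Real.exp (-(p * U))) / p -
        κ * (A U - Real.exp (-(p * U)) * K U) / p) (Real.exp (-s * u) * relaxation κ g u) u :=
      fun u => by
      refine (((hA' u).sub ((((hE u).const_sub 1).const_mul (g 0)).div_const p)).sub
        ((((hA' u).sub ((hE u).mul (hK' u))).const_mul κ).div_const p)).congr_deriv ?_
      have e1 : Real.exp (-(p * u)) = Real.exp (-s * u) * Real.exp (-κ * u) := by
        rw [← Real.exp_add]; congr 1; rw [hpdef]; ring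
      have e2 : Real.exp (-κ * u) * Real.exp (κ * u) = 1 := by rw [← Real.exp_add]; simp
      have e3 : relaxation κ g u =
        g u - Real.exp (-κ * u) * g 0 - κ * (Real.exp (-κ * u) * K u) := rfl
      rw [e1, e3]
      generalize Real.exp (-κ * u) = x at e2 ⊢
      generalize Real.exp (κ * u) = y at e2 ⊢
      field_simp
      linear_combination (κ * g u) * e2
    have := intervalIntegral.integral_eq_sub_of_hasDerivAt (a := 0) (b := U) (fun u _ => hd u)
      ((by have := continuous_relaxation κ hg; fun_prop :
        Continuous fun u => Real.exp (-s * u) * relaxation κ g u).intervalIntegrable _ _)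
    rw [this]
    simp [hA0, hK0]
  have hlim := (hL.sub (((hdecay.const_sub 1).const_mul (g 0)).div_const p)).sub
    (((hL.sub hKlim).const_mul κ).div_const p)
  refine (hlim.congr fun U => (hY U).symm).trans (le_of_eq ?_)
  congr 1
  field_simp
  rw [hpdef]
  ring

end LaplaceAnalysis

/-! ### The wsk-derivative and its transforms -/

section Transform

variable {F : Set ℝ} {α l : ℝ} {f : ℝ → ℝ}

theorem wskIntegrand_integrable_and_wskDeriv_eq (hS : IsStaircase F (staircase F α l))
    (N : ℝ → ℝ) (γ : ℝ)
    (hfS : ∀ x y : ℝ, 0 ≤ x → 0 ≤ y → staircase F α l x = staircase F α l y → f x = f y)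
    (hfD : ∀ x ∈ F, 0 ≤ x → ∃ d, HasFractalDerivWithinAt F α l (Set.Ici 0) f d x)
    {t : ℝ} (ht : 0 ≤ t)
    (hfI : FractalIntegrable F α l (fractalDerivWithin F α l (Set.Ici 0) f) 0 t) :
    FractalIntegrable F α l (wskIntegrand F α l γ 0 f t) 0 t ∧
      wskDeriv F α l N γ 0 f t = N γ / (1 - γ) *
        relaxation (γ / (1 - γ)) (fun u => f (levelMax (staircase F α l) u))
          (staircase F α l t) := by
  set S := staircase F α l with hSdef
  set κ := γ / (1 - γ)
  set g : ℝ → ℝ := fun u => f (levelMax S u)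
  have hg : Continuous g := continuous_comp_levelMax hS hfS hfD
  have hgd : ∀ w, 0 ≤ w → HasDerivWithinAt g _ (Set.Ici w) w :=
    fun w hw => hasDerivWithinAt_comp_levelMax hS hfD hw
  set φ : ℝ → ℝ := fun w => Real.exp (-κ * S t) * Real.exp (κ * w) with hφ
  -- The antiderivative of the weight times the right derivative of `g`, found by integrating by
  -- parts. No derivative of `g` appears in it, and its increment from `0` to `S t` is the
  -- relaxation.
  set Φ : ℝ → ℝ := fun u => Real.exp (-κ * S t) *
    (Real.exp (κ * u) * g u - κ * ∫ w in (0 : ℝ)..u, Real.exp (κ * w) * g w) with hΦ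
  have hI : ∀ u, HasDerivAt (fun u => ∫ w in (0 : ℝ)..u, Real.exp (κ * w) * g w)
      (Real.exp (κ * u) * g u) u := hasDerivAt_integral_zero (by fun_prop)
  have hIc : Continuous fun u => ∫ w in (0 : ℝ)..u, Real.exp (κ * w) * g w :=
    continuous_iff_continuousAt.2 fun u => (hI u).continuousAt
  have key := fractalIntegrable_mul hS (a := 0) le_rfl ht (φ := φ) (Φ := Φ) (by fun_prop)
    (fun w => by positivity) hg hgd (by fun_prop) (fun w hw => by
      refine ((((hasDerivAt_exp_mul κ w).hasDerivWithinAt.mul (hgd w hw)).sub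
        ((hI w).hasDerivWithinAt.const_mul κ)).const_mul (Real.exp (-κ * S t))).congr_deriv ?_
      simp only [hφ]
      ring) hfI
  have hw : wskIntegrand F α l γ 0 f t =
      fun τ => φ (S τ) * fractalDerivWithin F α l (Set.Ici 0) f τ := by
    funext τ
    simp only [wskIntegrand, hφ]
    rw [← Real.exp_add]
    congr 2
    simp only [κ]
    ring
  rw [← hSdef, ← hw] at key
  refine ⟨key.1, ?_⟩
  rw [wskDeriv, key.2]
  congr 1
  have e2 : Real.exp (-κ * S t) * Real.exp (κ * S t) = 1 := by rw [← Real.exp_add]; simp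
  simp only [hΦ, relaxation, hS.zero, mul_zero, Real.exp_zero, intervalIntegral.integral_same]
  linear_combination (g (S t)) * e2

/-- The common form of the Laplace and the Sumudu transform of the wsk-fractal derivative. -/
theorem transform_wskDeriv (hS : IsStaircase F (staircase F α l))
    (N : ℝ → ℝ) (γ : ℝ)
    (hfS : ∀ x y : ℝ, 0 ≤ x → 0 ≤ y → staircase F α l x = staircase F α l y → f x = f y)
    (hfD : ∀ x ∈ F, 0 ≤ x → ∃ d, HasFractalDerivWithinAt F α l (Set.Ici 0) f d x)
    (hfI : ∀ T, 0 ≤ T →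
      FractalIntegrable F α l (fractalDerivWithin F α l (Set.Ici 0) f) 0 T)
    {s L : ℝ} (hs : 0 < s + γ / (1 - γ))
    (hL : Tendsto (fun T => fractalIntegral F α l
      (fun t => Real.exp (-(s * staircase F α l t)) * f t) 0 T) atTop (𝓝 L)) :
    (∀ T, 0 ≤ T → FractalIntegrable F α l
      (fun t => Real.exp (-(s * staircase F α l t)) * wskDeriv F α l N γ 0 f t) 0 T) ∧
    Tendsto (fun T => fractalIntegral F α l
      (fun t => Real.exp (-(s * staircase F α l t)) * wskDeriv F α l N γ 0 f t) 0 T) atTop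
      (𝓝 (N γ / (1 - γ) * ((s * L - f 0) / (s + γ / (1 - γ))))) := by
  set κ := γ / (1 - γ)
  set S := staircase F α l
  set g : ℝ → ℝ := fun u => f (levelMax S u) with hgdef
  have hg : Continuous g := continuous_comp_levelMax hS hfS hfD
  have hgS : ∀ t, 0 ≤ t → g (S t) = f t := fun t ht =>
    hfS _ _ (hS.levelMax_nonneg _) ht (hS.apply_levelMax_of_nonneg (hS.nonneg ht))
  have hg0 : g 0 = f 0 := by rw [← hgS 0 le_rfl, hS.zero]
  have hf : ∀ T, 0 ≤ T → fractalIntegral F α l (fun t => Real.exp (-(s * S t)) * f t) 0 T =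
      ∫ u in (0 : ℝ)..(S T), Real.exp (-s * u) * g u := fun T hT => by
    have := (fractalIntegrable_of_eq_comp_staircase hS le_rfl hT
      (φ := fun u => Real.exp (-s * u) * g u) (k := fun t => Real.exp (-(s * S t)) * f t)
      (by fun_prop) (fun t ht => by simp only [hgS t ht.1, neg_mul, S])).2
    rwa [show staircase F α l 0 = 0 from hS.zero] at this
  have hG : Continuous (relaxation κ g) := continuous_relaxation κ hg
  have hw : ∀ T, 0 ≤ T → FractalIntegrable F α l
      (fun t => Real.exp (-(s * S t)) * wskDeriv F α l N γ 0 f t) 0 T ∧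
      fractalIntegral F α l (fun t => Real.exp (-(s * S t)) * wskDeriv F α l N γ 0 f t) 0 T =
      N γ / (1 - γ) * ∫ u in (0 : ℝ)..(S T), Real.exp (-s * u) * relaxation κ g u :=
    fun T hT => by
    have := fractalIntegrable_of_eq_comp_staircase hS le_rfl hT
      (φ := fun u => N γ / (1 - γ) * (Real.exp (-s * u) * relaxation κ g u))
      (k := fun t => Real.exp (-(s * S t)) * wskDeriv F α l N γ 0 f t)
      (by fun_prop) (fun t ht => by
        rw [(wskIntegrand_integrable_and_wskDeriv_eq hS N γ hfS hfD ht.1 (hfI t ht.1)).2,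
          neg_mul]
        ring)
    rwa [show staircase F α l 0 = 0 from hS.zero, intervalIntegral.integral_const_mul] at this
  refine ⟨fun T hT => (hw T hT).1, ?_⟩
  -- Taking `T = levelMax S U` realises every upper limit `U ≥ 0` as `S T`. The return from `U` to
  -- `T` is composition with `S`.
  have hL' : Tendsto (fun U => ∫ u in (0 : ℝ)..U, Real.exp (-s * u) * g u) atTop (𝓝 L) := by
    refine (hL.comp hS.tendsto_levelMax_atTop).congr' ?_
    filter_upwards [eventually_ge_atTop 0] with U hU
    simp only [Function.comp]
    rw [hf _ (hS.levelMax_nonneg U), hS.apply_levelMax_of_nonneg hU]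
  have := ((tendsto_integral_exp_mul_relaxation hs hg hL').comp hS.top).const_mul (N γ / (1 - γ))
  rw [hg0] at this
  refine this.congr' ?_
  filter_upwards [eventually_ge_atTop 0] with T hT
  exact (hw T hT).2.symm

end Transform

theorem theorem3p4 (F : Set ℝ) (α l : ℝ) (hα0 : 0 < α) (hα1 : α ≤ 1)
    (hF : IsAlphaPerfect F α l)
    (hS0 : staircase F α l 0 = 0)
    (hSinf : Tendsto (staircase F α l) atTop atTop)
    (N : ℝ → ℝ) (hN0 : N 0 = 1) (hN1 : N 1 = 1)
    (γ : ℝ) (hγ0 : 0 ≤ γ) (hγ1 : γ < 1)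
    (f : ℝ → ℝ)
    (hfS : ∀ x y : ℝ, 0 ≤ x → 0 ≤ y → staircase F α l x = staircase F α l y → f x = f y)
    (hfD : ∀ x ∈ F, 0 ≤ x → ∃ d, HasFractalDerivWithinAt F α l (Set.Ici 0) f d x)
    (hfI : ∀ T, 0 ≤ T →
      FractalIntegrable F α l (fractalDerivWithin F α l (Set.Ici 0) f) 0 T) :
    (∀ t, 0 ≤ t → FractalIntegrable F α l (wskIntegrand F α l γ 0 f t) 0 t) ∧
    (∀ v Lf : ℝ, 0 < staircase F α l v + γ / (1 - γ) → HasFractalLaplace F α l f v Lf →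
      HasFractalLaplace F α l (wskDeriv F α l N γ 0 f) v
        (N γ / (1 - γ) *
          ((staircase F α l v * Lf - f 0) / (staircase F α l v + γ / (1 - γ))))) ∧
    (∀ v Sf : ℝ, 0 < 1 / staircase F α l v + γ / (1 - γ) → HasFractalSumudu F α l f v Sf →
      HasFractalSumudu F α l (wskDeriv F α l N γ 0 f) v
        (N γ / (1 - γ) *
          ((Sf - f 0) / (1 + γ / (1 - γ) * staircase F α l v)))) := by
  have hS := hF.isStaircase hα0 hS0 hSinf
  refine ⟨fun t ht =>
    (wskIntegrand_integrable_and_wskDeriv_eq hS N γ hfS hfD ht (hfI t ht)).1, ?_, ?_⟩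
  · rintro v Lf hv ⟨-, hL⟩
    exact transform_wskDeriv hS N γ hfS hfD hfI hv hL
  · rintro v Sf hv ⟨hv0, -, hL⟩
    have e : ∀ h : ℝ → ℝ, (fun t => Real.exp (-(staircase F α l t / staircase F α l v)) * h t) =
        fun t => Real.exp (-(1 / staircase F α l v * staircase F α l t)) * h t := fun h => by
      funext t
      rw [one_div_mul_eq_div]
    -- Removing the prefactor `1 / S v` leaves a Laplace integral with `s = 1 / S v` and limit `S v
    -- * Sf`, so that `s * L = Sf`.
    have hL' := hL.const_mul (staircase F α l v)
    simp only [← mul_assoc, mul_one_div_cancel hv0, one_mul, e] at hL'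
    obtain ⟨h1, h2⟩ := transform_wskDeriv hS N γ hfS hfD hfI hv hL'
    refine ⟨hv0, ?_, ?_⟩
    · simpa only [e] using h1
    · simp only [e]
      refine (h2.const_mul (1 / staircase F α l v)).trans (le_of_eq ?_)
      congr 1
      have h3 : 1 + γ / (1 - γ) * staircase F α l v =
          staircase F α l v * (1 / staircase F α l v + γ / (1 - γ)) := by
        field_simp
      have h4 : 1 / staircase F α l v * (staircase F α l v * Sf) = Sf := by
        field_simp
      rw [h3, h4]
      have h5 := hv.ne'
      generalize 1 / staircase F α l v + γ / (1 - γ) = d at h5 ⊢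
      field_simp
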